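/- Let $(\Omega,\mu)$ be a probability space and let $\{X_n\}_{n\ge 1}\subset L_2(\Omega,\mu)$ be a sequence of centered independent complex-valued random variables. Let $\{p_n\}_{n\ge1}$ and $\{q_n\}_{n\ge1}$ be sequences of natural numbers, and put $p_n^*=\max_{1\le k\le n}p_k$, $q_n^*=\max_{1\le k\le n}q_k$ and $a\vee b=\max\{a,b\}$. If the series $$\sum_{n=1}^{\infty}\|X_n\|_2^2\,\log(n\vee p_n^*\vee q_n^*)\,(\log n)^2$$ converges, then there exists a set $\Omega^*\subset\Omega$ of full measure such that for every $\omega\in\Omega^*$ the following holds. For every probability space $(Y,\pi)$, all commuting linear contractions $T_1,T_2$ on the complex space $L_2(Y,\pi)$ and every $f\in L_2(Y,\pi)$, the series $$\sum_{n=1}^{\infty}X_n(\omega)\,T_1^{p_n}T_2^{q_n}f\quad\text{converges } \pi\text{-a.e.}$$ Furthermore, for every $\omega\in\Omega^*$ there exists a constant $K_\omega<\infty$, depending on $\omega$ but not on $(Y,\pi)$, $T_1$, $T_2$ or $f$, such that for all such $(Y,\pi)$, $T_1$, $T_2$ and $f$ $$\left\|\,\sup_{n\ge1}\left|\sum_{k=1}^{n}X_k(\omega)\,T_1^{p_k}T_2^{q_k}f\right|\,\right\|_{L_2(\pi)}\le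 K_\omega\,\|f\|_{L_2(\pi)}.$$ -/

import Mathlib

open Filter Topology MeasureTheory ProbabilityTheory
open scoped ENNReal NNReal

universe u v

/-- The running maximum `c_n^* = max_{1 ≤ k ≤ n} c_k` of a sequence of natural numbers indexed by
the positive integers. -/
def runMax (c : ℕ+ → ℕ) (n : ℕ+) : ℕ := (Finset.Icc 1 n).sup c

/-- The value at `y` of the `n`-th partial sum `∑_{k=1}^n a_k T₁^{p_k} T₂^{q_k} f` of the weighted
series along the powers `(p_k, q_k)`, for bounded operators on the complex space `L₂(Y, π)`. -/
noncomputable def weightedPartialSum {Y : Type v} [MeasurableSpace Y] {π : Measure Y}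
    (a : ℕ+ → ℂ) (p q : ℕ+ → ℕ) (T₁ T₂ : Lp ℂ 2 π →L[ℂ] Lp ℂ 2 π) (f : Lp ℂ 2 π)
    (n : ℕ+) (y : Y) : ℂ :=
  ∑ k ∈ Finset.Icc 1 n, a k * ((T₁ ^ p k) ((T₂ ^ q k) f) : Lp ℂ 2 π) y

/-! By Ando's inequality, the norm of a finite sum `∑_{k ∈ J} X_k T₁^{p_k} T₂^{q_k}` is controlled
by the size of the trigonometric polynomial `∑_{k ∈ J} X_k z^{p_k} w^{q_k}` alone, whatever the
Hilbert space and the commuting contractions. The operators thus disappear and leave one random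
constant per finite set `J` (`exists_control`), which is why a single null set serves all `Y`, `T₁`,
`T₂`, `f`. The torus is replaced by a finite grid: lift the pair to commuting isometries, apply
Parseval on `(ℤ/2D)²` to an orbit, and lose a factor 2 at the edge (`enorm_sum_smul_pow_pow_le`).

The maximum of the polynomial over the `(2D)²` characters has second moment `O(log D) ∑ ‖X_k‖₂²`, by
symmetrization and exponential moments of Rademacher sums (`lintegral_enorm_sum_smul_sq_le`).

Passing to partial sums is a Rademacher–Menshov argument. The indices are cut into consecutive
blocks by rank; complete blocks are added by a weighted Cauchy–Schwarz inequality, and the last,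
incomplete one is split into dyadic pieces. Both costs are gathered in `maximalSquare`, which is
linear in the squared norms of the block sums. It can therefore be integrated over `Y`, then over
`Ω`, where the hypothesis makes it finite.

Plain dyadic blocks would fail: the degree may jump inside a block, and the logarithm at its last
index could not be charged to the earlier terms. Hence the rank of `n` is the logarithm of `n` times
its weight, so that weights vary by at most 2 within a rank. The weight is capped at `n` to keep the
rank `O(log n)`; where the cap acts, Cauchy–Schwarz replaces the random estimate. -/

/-! ### Fourier analysis on finite abelian groups -/

section FiniteFourier

variable {G E ι : Type*} [AddCommGroup G] [Fintype G] [NormedAddCommGroup E]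
  [InnerProductSpace ℂ E]

/-- Parseval's identity for vector-valued functions on a finite abelian group. -/
theorem AddChar.sum_norm_sq_sum_smul (φ : G → E) :
    ∑ χ : AddChar G ℂ, ‖∑ g, χ g • φ g‖ ^ 2 = Fintype.card G * ∑ g, ‖φ g‖ ^ 2 := by
  classical
  have h : ∀ χ : AddChar G ℂ, ((‖∑ g, χ g • φ g‖ ^ 2 : ℝ) : ℂ)
      = ∑ g, ∑ g', χ (g' - g) * inner ℂ (φ g) (φ g') := by
    intro χ
    rw [Complex.ofReal_pow, ← RCLike.ofReal_eq_complex_ofReal,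
      ← inner_self_eq_norm_sq_to_K (𝕜 := ℂ), sum_inner]
    refine Finset.sum_congr rfl fun g _ => ?_
    rw [inner_sum]
    refine Finset.sum_congr rfl fun g' _ => ?_
    rw [inner_smul_left, inner_smul_right, sub_eq_add_neg, AddChar.map_add_eq_mul,
      AddChar.map_neg_eq_conj]
    ring
  have h2 : ((∑ χ : AddChar G ℂ, ‖∑ g, χ g • φ g‖ ^ 2 : ℝ) : ℂ)
      = ((Fintype.card G * ∑ g, ‖φ g‖ ^ 2 : ℝ) : ℂ) := by
    rw [Complex.ofReal_sum, Finset.sum_congr rfl fun χ _ => h χ, Finset.sum_comm]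
    push_cast
    rw [Finset.mul_sum]
    refine Finset.sum_congr rfl fun g _ => ?_
    rw [Finset.sum_comm]
    simp_rw [← Finset.sum_mul, AddChar.sum_apply_eq_ite, sub_eq_zero, ite_mul, zero_mul]
    rw [Finset.sum_ite_eq' Finset.univ g, if_pos (Finset.mem_univ _),
      inner_self_eq_norm_sq_to_K (𝕜 := ℂ)]
    rfl
  exact_mod_cast h2

/-- A convolution operator on a finite abelian group has norm at most the supremum of its
symbol over the characters of the group. -/
theorem AddChar.sum_norm_sq_convolution_le (J : Finset ι) (a : ι → ℂ) (κ : ι → G) (φ : G → E)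
    {C : ℝ} (hC : ∀ χ : AddChar G ℂ, ‖∑ k ∈ J, a k * χ (κ k)‖ ≤ C) :
    ∑ g, ‖∑ k ∈ J, a k • φ (g + κ k)‖ ^ 2 ≤ C ^ 2 * ∑ g, ‖φ g‖ ^ 2 := by
  have hC0 : 0 ≤ C := (norm_nonneg _).trans (hC 1)
  have hcard : (0 : ℝ) < Fintype.card G := by exact_mod_cast Fintype.card_pos
  refine le_of_mul_le_mul_left ?_ hcard
  rw [mul_left_comm, ← AddChar.sum_norm_sq_sum_smul, ← AddChar.sum_norm_sq_sum_smul,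
    Finset.mul_sum]
  refine Finset.sum_le_sum fun χ _ => ?_
  have key : ∑ g, χ g • ∑ k ∈ J, a k • φ (g + κ k)
      = (∑ k ∈ J, a k * χ⁻¹ (κ k)) • ∑ g, χ g • φ g := by
    simp_rw [Finset.smul_sum]
    rw [Finset.sum_comm, ← Finset.smul_sum, Finset.sum_smul]
    refine Finset.sum_congr rfl fun k _ => ?_
    rw [Finset.smul_sum]
    refine Fintype.sum_equiv (Equiv.addRight (κ k)) _ _ fun g => ?_
    simp only [Equiv.coe_addRight, smul_smul]
    congr 1
    rw [AddChar.map_add_eq_mul, AddChar.inv_apply, mul_assoc, mul_comm (χ g) (χ (κ k)),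
      ← mul_assoc (χ (-κ k)), ← AddChar.map_add_eq_mul, neg_add_cancel,
      AddChar.map_zero_eq_one, one_mul, mul_comm]
  rw [key, norm_smul, mul_pow]
  gcongr
  exact hC _

theorem AddChar.sum_enorm_sq_convolution_le (J : Finset ι) (a : ι → ℂ) (κ : ι → G) (φ : G → E)
    {C : ℝ≥0} (hC : ∀ χ : AddChar G ℂ, ‖∑ k ∈ J, a k * χ (κ k)‖ ≤ C) :
    ∑ g, ‖∑ k ∈ J, a k • φ (g + κ k)‖ₑ ^ 2 ≤ (C : ℝ≥0∞) ^ 2 * ∑ g, ‖φ g‖ₑ ^ 2 := by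
  have h := AddChar.sum_norm_sq_convolution_le J a κ φ hC
  simp only [enorm_eq_nnnorm]
  have h' : ∑ g, ‖∑ k ∈ J, a k • φ (g + κ k)‖₊ ^ 2 ≤ C ^ 2 * ∑ g, ‖φ g‖₊ ^ 2 := by
    rw [← NNReal.coe_le_coe]
    push_cast
    exact h
  exact_mod_cast h'

end FiniteFourier

/-! ### Extending an isometry between subspaces to a unitary -/

section Dilation

variable {H F : Type*} [NormedAddCommGroup H] [InnerProductSpace ℂ H]
  [NormedAddCommGroup F] [InnerProductSpace ℂ F] [CompleteSpace F]

/-- Two linear maps with the same Gram form are intertwined by an isometry between the closures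
of their ranges. -/
theorem exists_isometry_of_norm_eq (A B : H →ₗ[ℂ] F) (hAB : ∀ h, ‖A h‖ = ‖B h‖) :
    ∃ u : A.range.topologicalClosure →L[ℂ] B.range.topologicalClosure,
      (∀ x, ‖u x‖ = ‖x‖) ∧
      (∀ h (hA : A h ∈ A.range.topologicalClosure), (u ⟨A h, hA⟩ : F) = B h) := by
  have hmA : ∀ h, A h ∈ A.range.topologicalClosure := fun h =>
    A.range.le_topologicalClosure (LinearMap.mem_range_self A h)
  have hmB : ∀ h, B h ∈ B.range.topologicalClosure := fun h =>
    B.range.le_topologicalClosure (LinearMap.mem_range_self B h)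
  let e : H →ₗ[ℂ] A.range.topologicalClosure := A.codRestrict _ hmA
  let f : H →ₗ[ℂ] B.range.topologicalClosure := B.codRestrict _ hmB
  have he : DenseRange e := by
    rw [DenseRange, dense_iff_closure_eq]
    ext x
    simp only [Set.mem_univ, iff_true]
    rw [closure_subtype]
    have : Subtype.val '' Set.range e = (A.range : Set F) := by
      ext y
      constructor
      · rintro ⟨_, ⟨h, rfl⟩, rfl⟩
        exact ⟨h, rfl⟩
      · rintro ⟨h, rfl⟩
        exact ⟨e h, ⟨h, rfl⟩, rfl⟩
    rw [this]
    exact x.2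
  have hnorm : ∀ h, ‖f h‖ ≤ 1 * ‖e h‖ := fun h => by
    rw [one_mul]; exact (hAB h).ge
  have hue : ∀ h, f.extendOfNorm e (e h) = f h :=
    LinearMap.extendOfNorm_eq he ⟨1, hnorm⟩
  refine ⟨f.extendOfNorm e, fun x => ?_, fun h hA => ?_⟩
  · refine he.induction_on (p := fun x => ‖f.extendOfNorm e x‖ = ‖x‖) x
      (isClosed_eq (by fun_prop) (by fun_prop)) fun h => ?_
    rw [hue]
    exact (hAB h).symm
  · exact congrArg Subtype.val (hue h)

/-- Two linear maps with the same Gram form are intertwined by a unitary of the doubled space. -/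
theorem exists_unitary_of_norm_eq (A B : H →ₗ[ℂ] F) (hAB : ∀ h, ‖A h‖ = ‖B h‖) :
    ∃ G : (F × F) ≃ₗ[ℂ] (F × F),
      (∀ x, ‖(G x).1‖ ^ 2 + ‖(G x).2‖ ^ 2 = ‖x.1‖ ^ 2 + ‖x.2‖ ^ 2) ∧
      ∀ h, G (A h, 0) = (B h, 0) := by
  obtain ⟨u, hu, huA⟩ := exists_isometry_of_norm_eq A B hAB
  obtain ⟨w, hw, hwB⟩ := exists_isometry_of_norm_eq B A fun h => (hAB h).symm
  let M := A.range.topologicalClosure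
  let N := B.range.topologicalClosure
  have hmA : ∀ h, A h ∈ M := fun h =>
    A.range.le_topologicalClosure (LinearMap.mem_range_self A h)
  have hmB : ∀ h, B h ∈ N := fun h =>
    B.range.le_topologicalClosure (LinearMap.mem_range_self B h)
  have inv : ∀ (A B : H →ₗ[ℂ] F)
      (u : A.range.topologicalClosure →L[ℂ] B.range.topologicalClosure)
      (w : B.range.topologicalClosure →L[ℂ] A.range.topologicalClosure)
      (_ : ∀ h (hA : A h ∈ A.range.topologicalClosure), (u ⟨A h, hA⟩ : F) = B h)
      (_ : ∀ h (hB : B h ∈ B.range.topologicalClosure), (w ⟨B h, hB⟩ : F) = A h),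
      ∀ x, w (u x) = x := by
    intro A B u w huA hwB x
    have hd : Dense {y : A.range.topologicalClosure | (y : F) ∈ A.range} := by
      rw [dense_iff_closure_eq]
      ext x
      simp only [Set.mem_univ, iff_true]
      rw [closure_subtype]
      have : Subtype.val '' {y : A.range.topologicalClosure | (y : F) ∈ A.range}
          = (A.range : Set F) := by
        ext y
        constructor
        · rintro ⟨_, hy, rfl⟩
          exact hy
        · intro hy
          exact ⟨⟨y, A.range.le_topologicalClosure hy⟩, hy, rfl⟩
      rw [this]
      exact x.2
    refine hd.induction (P := fun x => w (u x) = x) ?_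
      (isClosed_eq (by fun_prop) (by fun_prop)) x
    rintro ⟨_, hx⟩ ⟨h, rfl⟩
    apply Subtype.ext
    have h1 : u ⟨A h, hx⟩ = ⟨B h, B.range.le_topologicalClosure (LinearMap.mem_range_self B h)⟩ :=
      Subtype.ext (huA h hx)
    rw [h1, hwB]
  have hwu := inv A B u w huA hwB
  have huw := inv B A w u hwB huA
  let L : F →ₗ[ℂ] F := (N.subtypeL ∘L u ∘L M.orthogonalProjectionOnto).toLinearMap
  let L' : F →ₗ[ℂ] F := (M.subtypeL ∘L w ∘L N.orthogonalProjectionOnto).toLinearMap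
  let P : F →ₗ[ℂ] F := M.starProjection.toLinearMap
  let Q : F →ₗ[ℂ] F := N.starProjection.toLinearMap
  have hLN : ∀ x, L x ∈ N := fun x => Subtype.coe_prop _
  have hL'M : ∀ x, L' x ∈ M := fun x => Subtype.coe_prop _
  have hPM : ∀ x, P x ∈ M := fun x => M.starProjection_apply_mem x
  have hQN : ∀ x, Q x ∈ N := fun x => N.starProjection_apply_mem x
  have hP : ∀ x ∈ M, P x = x := fun x hx => Submodule.starProjection_eq_self_iff.2 hx
  have hQ : ∀ x ∈ N, Q x = x := fun x hx => Submodule.starProjection_eq_self_iff.2 hx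
  have hPsub : ∀ x, x - P x ∈ Mᗮ := fun x => M.sub_starProjection_mem_orthogonal x
  have hQsub : ∀ x, x - Q x ∈ Nᗮ := fun x => N.sub_starProjection_mem_orthogonal x
  have hLM : ∀ x ∈ Mᗮ, L x = 0 := fun x hx => by
    simp [L, Submodule.orthogonalProjectionOnto_eq_zero_iff.2 hx]
  have hL'N : ∀ x ∈ Nᗮ, L' x = 0 := fun x hx => by
    simp [L', Submodule.orthogonalProjectionOnto_eq_zero_iff.2 hx]
  have hL'L : ∀ x, L' (L x) = P x := fun x => by
    simp [L, L', P, hwu]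
  have hLL' : ∀ x, L (L' x) = Q x := fun x => by
    simp [L, L', Q, huw]
  have hnL : ∀ x, ‖L x‖ = ‖P x‖ := fun x => hu (M.orthogonalProjectionOnto x)
  have hnL' : ∀ x, ‖L' x‖ = ‖Q x‖ := fun x => hw (N.orthogonalProjectionOnto x)
  have hPL' : ∀ x, P (L' x) = L' x := fun x => hP _ (hL'M x)
  have hQL : ∀ x, Q (L x) = L x := fun x => hQ _ (hLN x)
  have hPP : ∀ x, P (P x) = P x := fun x => hP _ (hPM x)
  have hQQ : ∀ x, Q (Q x) = Q x := fun x => hQ _ (hQN x)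
  have hLP : ∀ x, L (P x) = L x := fun x => by
    have := hLM _ (hPsub x)
    rw [map_sub, sub_eq_zero] at this
    exact this.symm
  have hL'Q : ∀ x, L' (Q x) = L' x := fun x => by
    have := hL'N _ (hQsub x)
    rw [map_sub, sub_eq_zero] at this
    exact this.symm
  have pyth : ∀ (S : Submodule ℂ F) (x y : F), x ∈ S → y ∈ Sᗮ →
      ‖x + y‖ ^ 2 = ‖x‖ ^ 2 + ‖y‖ ^ 2 := fun S x y hx hy => by
    have := norm_add_sq_eq_norm_sq_add_norm_sq_of_inner_eq_zero (𝕜 := ℂ) x y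
      (Submodule.inner_right_of_mem_orthogonal hx hy)
    simpa [sq] using this
  -- A Halmos-type matrix. `L` carries `M` isometrically onto `N`, but `Mᗮ` and `Nᗮ` may have
  -- different dimensions, so `L` need not extend to a unitary of `F`. In the doubled space each
  -- complement is simply moved to the other coordinate, and `L'` carries the second copy of `N`
  -- back to `M`.
  let G₁ : (F × F) →ₗ[ℂ] (F × F) :=
    LinearMap.prod (L ∘ₗ LinearMap.fst ℂ F F + (LinearMap.id - Q) ∘ₗ LinearMap.snd ℂ F F)
      ((LinearMap.id - P) ∘ₗ LinearMap.fst ℂ F F - L' ∘ₗ LinearMap.snd ℂ F F)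
  let G₂ : (F × F) →ₗ[ℂ] (F × F) :=
    LinearMap.prod (L' ∘ₗ LinearMap.fst ℂ F F + (LinearMap.id - P) ∘ₗ LinearMap.snd ℂ F F)
      ((LinearMap.id - Q) ∘ₗ LinearMap.fst ℂ F F - L ∘ₗ LinearMap.snd ℂ F F)
  refine ⟨LinearEquiv.ofLinearMap G₁ G₂ ?_ ?_, ?_, ?_⟩
  · refine LinearMap.ext fun x => Prod.ext ?_ ?_
    · simp [G₁, G₂, hLL', hLP, hQL, hQQ]
    · simp [G₁, G₂, hL'L, hPL', hL'Q, hPP]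
  · refine LinearMap.ext fun x => Prod.ext ?_ ?_
    · simp [G₁, G₂, hL'L, hL'Q, hPL', hPP]
    · simp [G₁, G₂, hLL', hQL, hLP, hQQ]
  · intro x
    have h1 : ‖(G₁ x).1‖ ^ 2 = ‖P x.1‖ ^ 2 + ‖x.2 - Q x.2‖ ^ 2 := by
      rw [← hnL]
      exact pyth N _ _ (hLN _) (hQsub _)
    have h2 : ‖(G₁ x).2‖ ^ 2 = ‖Q x.2‖ ^ 2 + ‖x.1 - P x.1‖ ^ 2 := by
      have : (G₁ x).2 = -L' x.2 + (x.1 - P x.1) := by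
        simp only [G₁, LinearMap.prod_apply]
        simp [sub_eq_add_neg, add_comm, add_left_comm]
      rw [this, ← hnL', ← norm_neg (L' x.2)]
      exact pyth M _ _ (M.neg_mem (hL'M _)) (hPsub _)
    have h3 := pyth M (P x.1) (x.1 - P x.1) (hPM _) (hPsub _)
    have h4 := pyth N (Q x.2) (x.2 - Q x.2) (hQN _) (hQsub _)
    rw [add_sub_cancel] at h3 h4
    change ‖(G₁ x).1‖ ^ 2 + ‖(G₁ x).2‖ ^ 2 = _
    rw [h1, h2, h3, h4]
    ring
  · intro h
    change G₁ (A h, 0) = (B h, 0)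
    have hLA : L (A h) = B h := by
      have h1 : M.orthogonalProjectionOnto (A h) = ⟨A h, hmA h⟩ :=
        Submodule.orthogonalProjectionOnto_mem_subspace_eq_self (⟨A h, hmA h⟩ : M)
      simp only [L, ContinuousLinearMap.coe_coe, ContinuousLinearMap.comp_apply, h1]
      exact huA h _
    refine Prod.ext ?_ ?_
    · simp [G₁, hLA]
    · simp [G₁, hP _ (hmA h)]

end Dilation

/-! ### Ando's dilation and the grid form of Ando's inequality -/

section Ando

variable {H : Type*} [NormedAddCommGroup H] [InnerProductSpace ℂ H]

/-- The space on which a commuting pair of contractions of `H` is dilated: sequences need not be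
square summable. -/
abbrev DilationSpace (H : Type*) : Type _ := H × (ℕ → WithLp 2 (H × H) × WithLp 2 (H × H))

/-- The square of the (possibly infinite) Hilbert norm on the dilation space. -/
noncomputable def dilationNormSq (x : DilationSpace H) : ℝ≥0∞ :=
  ‖x.1‖ₑ ^ 2 + ∑' i, (‖(x.2 i).1‖ₑ ^ 2 + ‖(x.2 i).2‖ₑ ^ 2)

/-- The sequence part of the isometric lifting of a contraction `T` with defect operator `D`. -/
def liftSeq (D : H →ₗ[ℂ] H) (x : DilationSpace H) :
    ℕ → WithLp 2 (H × H) × WithLp 2 (H × H)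
  | 0 => (WithLp.toLp 2 (D x.1, (x.2 0).1.fst), WithLp.toLp 2 (0, (x.2 0).2.fst))
  | i + 1 => (WithLp.toLp 2 ((x.2 i).1.snd, (x.2 (i + 1)).1.fst),
      WithLp.toLp 2 ((x.2 i).2.snd, (x.2 (i + 1)).2.fst))

/-- The isometric lifting of a contraction `T` with defect operator `D`. -/
def isometricLift (T D : H →ₗ[ℂ] H) : DilationSpace H →ₗ[ℂ] DilationSpace H where
  toFun x := (T x.1, liftSeq D x)
  map_add' x y := by
    refine Prod.ext (by simp) (funext fun i => ?_)
    cases i <;> simp [liftSeq, ← WithLp.toLp_add]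
  map_smul' c x := by
    refine Prod.ext (by simp) (funext fun i => ?_)
    cases i <;> simp [liftSeq, ← WithLp.toLp_smul]

omit [InnerProductSpace ℂ H] in
theorem enorm_toLp_pair_sq (a b : H) :
    ‖WithLp.toLp 2 (a, b)‖ₑ ^ 2 = ‖a‖ₑ ^ 2 + ‖b‖ₑ ^ 2 := by
  have h : ‖WithLp.toLp 2 (a, b)‖₊ ^ 2 = ‖a‖₊ ^ 2 + ‖b‖₊ ^ 2 := by
    rw [← NNReal.coe_inj]
    push_cast
    exact WithLp.prod_norm_sq_eq_of_L2 _
  simp only [enorm_eq_nnnorm]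
  exact_mod_cast h

omit [InnerProductSpace ℂ H] in
theorem enorm_withLp_sq (z : WithLp 2 (H × H)) : ‖z‖ₑ ^ 2 = ‖z.fst‖ₑ ^ 2 + ‖z.snd‖ₑ ^ 2 :=
  enorm_toLp_pair_sq z.fst z.snd

theorem dilationNormSq_isometricLift (T D : H →ₗ[ℂ] H)
    (hD : ∀ h, ‖T h‖ₑ ^ 2 + ‖D h‖ₑ ^ 2 = ‖h‖ₑ ^ 2) (x : DilationSpace H) :
    dilationNormSq (isometricLift T D x) = dilationNormSq x := by
  have hs : ∀ f : ℕ → ℝ≥0∞, ∑' i, f i = f 0 + ∑' i, f (i + 1) := fun f =>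
    tsum_eq_zero_add' ENNReal.summable
  simp only [dilationNormSq, isometricLift, LinearMap.coe_mk, AddHom.coe_mk]
  rw [hs, ← hD x.1]
  simp only [liftSeq, enorm_toLp_pair_sq]
  simp only [enorm_withLp_sq, ENNReal.tsum_add]
  rw [hs fun i => ‖(x.2 i).1.fst‖ₑ ^ 2, hs fun i => ‖(x.2 i).2.fst‖ₑ ^ 2]
  simp only [enorm_zero, ne_eq, OfNat.ofNat_ne_zero, not_false_eq_true, zero_pow]
  ring

/-- The pointwise action of a linear automorphism on the sequence part. -/
def sequenceMap (G : (WithLp 2 (H × H) × WithLp 2 (H × H)) →ₗ[ℂ] WithLp 2 (H × H) × WithLp 2 (H × H)) :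
    DilationSpace H →ₗ[ℂ] DilationSpace H where
  toFun x := (x.1, fun i => G (x.2 i))
  map_add' x y := by simp [Prod.ext_iff, funext_iff]
  map_smul' c x := by simp [Prod.ext_iff, funext_iff]

theorem dilationNormSq_sequenceMap
    (G : (WithLp 2 (H × H) × WithLp 2 (H × H)) →ₗ[ℂ] WithLp 2 (H × H) × WithLp 2 (H × H))
    (hG : ∀ x, ‖(G x).1‖ ^ 2 + ‖(G x).2‖ ^ 2 = ‖x.1‖ ^ 2 + ‖x.2‖ ^ 2) (x : DilationSpace H) :
    dilationNormSq (sequenceMap G x) = dilationNormSq x := by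
  have h : ∀ x, ‖(G x).1‖ₑ ^ 2 + ‖(G x).2‖ₑ ^ 2 = ‖x.1‖ₑ ^ 2 + ‖x.2‖ₑ ^ 2 := fun x => by
    have h : ‖(G x).1‖₊ ^ 2 + ‖(G x).2‖₊ ^ 2 = ‖x.1‖₊ ^ 2 + ‖x.2‖₊ ^ 2 := by
      rw [← NNReal.coe_inj]
      push_cast
      exact hG x
    simp only [enorm_eq_nnnorm]
    exact_mod_cast h
  simp only [dilationNormSq, sequenceMap, LinearMap.coe_mk, AddHom.coe_mk, h]

/-- A contraction on a Hilbert space has a defect operator. -/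
theorem exists_defect [CompleteSpace H] (T : H →L[ℂ] H) (hT : ‖T‖ ≤ 1) :
    ∃ D : H →L[ℂ] H, ∀ h, ‖T h‖ₑ ^ 2 + ‖D h‖ₑ ^ 2 = ‖h‖ₑ ^ 2 := by
  have hpos : 0 ≤ 1 - ContinuousLinearMap.adjoint T ∘L T := by
    rw [ContinuousLinearMap.nonneg_iff_isPositive]
    refine ⟨?_, fun x => ?_⟩
    · refine LinearMap.IsSymmetric.sub (fun _ _ => rfl) fun x y => ?_
      simp [ContinuousLinearMap.adjoint_inner_left, ContinuousLinearMap.adjoint_inner_right]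
    · have h1 : ‖T x‖ ≤ ‖x‖ := T.le_of_opNorm_le_of_le hT le_rfl |>.trans_eq (one_mul _)
      have h2 : ‖T x‖ ^ 2 ≤ ‖x‖ ^ 2 := by gcongr
      rw [ContinuousLinearMap.reApplyInnerSelf_apply]
      simp only [sub_apply, one_apply_eq_self, ContinuousLinearMap.comp_apply,
        inner_sub_left, map_sub, ContinuousLinearMap.adjoint_inner_left, inner_self_eq_norm_sq]
      linarith
  have hsa : IsSelfAdjoint (CFC.sqrt (1 - ContinuousLinearMap.adjoint T ∘L T)) :=
    (CFC.sqrt_nonneg _).isSelfAdjoint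
  refine ⟨CFC.sqrt (1 - ContinuousLinearMap.adjoint T ∘L T), fun h => ?_⟩
  set D := CFC.sqrt (1 - ContinuousLinearMap.adjoint T ∘L T) with hDdef
  have hDD : D ∘L D = 1 - ContinuousLinearMap.adjoint T ∘L T := CFC.sqrt_mul_sqrt_self _ hpos
  have key : ‖T h‖ ^ 2 + ‖D h‖ ^ 2 = ‖h‖ ^ 2 := by
    have h1 : ‖D h‖ ^ 2 = RCLike.re (inner ℂ ((D ∘L D) h) h) := by
      rw [ContinuousLinearMap.comp_apply, ← ContinuousLinearMap.adjoint_inner_right,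
        hsa.adjoint_eq, inner_self_eq_norm_sq]
    rw [h1, hDD]
    simp only [sub_apply, one_apply_eq_self, ContinuousLinearMap.comp_apply,
      inner_sub_left, map_sub, ContinuousLinearMap.adjoint_inner_left, inner_self_eq_norm_sq]
    ring
  have key' : ‖T h‖₊ ^ 2 + ‖D h‖₊ ^ 2 = ‖h‖₊ ^ 2 := by
    rw [← NNReal.coe_inj]
    push_cast
    exact key
  simp only [enorm_eq_nnnorm]
  exact_mod_cast key'

/-- **Ando's dilation theorem**: a commuting pair of contractions lifts to a commuting pair of
isometries. -/
theorem exists_commuting_isometricLift [CompleteSpace H] (T₁ T₂ : H →L[ℂ] H) (h₁ : ‖T₁‖ ≤ 1)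
    (h₂ : ‖T₂‖ ≤ 1) (hT : Commute T₁ T₂) :
    ∃ V₁ V₂ : DilationSpace H →ₗ[ℂ] DilationSpace H, Commute V₁ V₂ ∧
      (∀ x, dilationNormSq (V₁ x) = dilationNormSq x) ∧
      (∀ x, dilationNormSq (V₂ x) = dilationNormSq x) ∧
      (∀ x, (V₁ x).1 = T₁ x.1) ∧ ∀ x, (V₂ x).1 = T₂ x.1 := by
  obtain ⟨D₁, hD₁⟩ := exists_defect T₁ h₁
  obtain ⟨D₂, hD₂⟩ := exists_defect T₂ h₂
  have hcomm : ∀ h, T₁ (T₂ h) = T₂ (T₁ h) := fun h => congrArg (fun S => S h) hT.eq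
  let pair : (H →L[ℂ] H) → (H →L[ℂ] H) → H →ₗ[ℂ] WithLp 2 (H × H) := fun S S' =>
    (WithLp.linearEquiv 2 ℂ (H × H)).symm.toLinearMap ∘ₗ S.toLinearMap.prod S'.toLinearMap
  have hpair : ∀ S S' h, pair S S' h = WithLp.toLp 2 (S h, S' h) := fun _ _ _ => rfl
  let A := pair (D₁ ∘L T₂) D₂
  let B := pair (D₂ ∘L T₁) D₁
  have hAB : ∀ h, ‖A h‖ = ‖B h‖ := fun h => by
    -- Adding this common finite term turns both sides into `‖h‖ₑ ^ 2`, by the defect identities and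
    -- commutation.
    have e1 : ‖A h‖ₑ ^ 2 + ‖T₁ (T₂ h)‖ₑ ^ 2 = ‖B h‖ₑ ^ 2 + ‖T₁ (T₂ h)‖ₑ ^ 2 := by
      have a1 := hD₁ (T₂ h)
      have a2 := hD₂ (T₁ h)
      have a3 := hD₁ h
      have a4 := hD₂ h
      simp only [A, B, hpair, enorm_toLp_pair_sq, ContinuousLinearMap.comp_apply]
      calc ‖D₁ (T₂ h)‖ₑ ^ 2 + ‖D₂ h‖ₑ ^ 2 + ‖T₁ (T₂ h)‖ₑ ^ 2
          = (‖T₁ (T₂ h)‖ₑ ^ 2 + ‖D₁ (T₂ h)‖ₑ ^ 2) + ‖D₂ h‖ₑ ^ 2 := by ring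
        _ = (‖T₂ (T₁ h)‖ₑ ^ 2 + ‖D₂ (T₁ h)‖ₑ ^ 2) + ‖D₁ h‖ₑ ^ 2 := by
            rw [a1, a4, a2, a3]
        _ = _ := by rw [hcomm]; ring
    rw [ENNReal.add_left_inj (by finiteness)] at e1
    have e2 : ‖A h‖ₑ = ‖B h‖ₑ := (ENNReal.pow_right_strictMono two_ne_zero).injective e1
    simpa [enorm_eq_nnnorm] using congrArg ENNReal.toReal e2
  obtain ⟨G, hG, hGA⟩ := exists_unitary_of_norm_eq A B hAB
  have hGs : ∀ x, ‖(G.symm x).1‖ ^ 2 + ‖(G.symm x).2‖ ^ 2 = ‖x.1‖ ^ 2 + ‖x.2‖ ^ 2 := fun x => by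
    rw [← hG, G.apply_symm_apply]
  let W₁ : DilationSpace H →ₗ[ℂ] DilationSpace H := isometricLift T₁.toLinearMap D₁.toLinearMap
  let W₂ : DilationSpace H →ₗ[ℂ] DilationSpace H := isometricLift T₂.toLinearMap D₂.toLinearMap
  -- Each lift shifts by half an entry, so two lifts shift by exactly one entry and the shift
  -- commutes with the entrywise action of `G`. The two orders then differ only in entry 0, which is
  -- `(A h, 0)` or `(B h, 0)`, and `G` sends the first to the second.
  have hW : ∀ y, sequenceMap G.toLinearMap (W₁ (W₂ y))
      = W₂ (W₁ (sequenceMap G.toLinearMap y)) := fun y => by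
    refine Prod.ext (hcomm y.1) (funext fun i => ?_)
    cases i with
    | zero => exact hGA y.1
    | succ i => cases i <;> rfl
  have hGG : ∀ y, sequenceMap G.toLinearMap (sequenceMap G.symm.toLinearMap y) = y := fun y =>
    Prod.ext rfl (funext fun i => G.apply_symm_apply _)
  have hGG' : ∀ y, sequenceMap G.symm.toLinearMap (sequenceMap G.toLinearMap y) = y := fun y =>
    Prod.ext rfl (funext fun i => G.symm_apply_apply _)
  -- With `V₁ = G W₁` and `V₂ = W₂ G⁻¹`, both products equal `W₂ W₁`.
  refine ⟨sequenceMap G.toLinearMap ∘ₗ W₁, W₂ ∘ₗ sequenceMap G.symm.toLinearMap, ?_, fun x => ?_,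
    fun x => ?_, fun x => rfl, fun x => rfl⟩
  · refine LinearMap.ext fun x => ?_
    simp only [Module.End.mul_apply, LinearMap.comp_apply]
    rw [hW, hGG, hGG']
  · rw [LinearMap.comp_apply, dilationNormSq_sequenceMap _ hG]
    exact dilationNormSq_isometricLift _ _ hD₁ x
  · rw [LinearMap.comp_apply]
    exact (dilationNormSq_isometricLift _ _ hD₂ _).trans (dilationNormSq_sequenceMap _ hGs x)

/-- The Fourier bound holds in every Hilbert coordinate with the same constant, so it can be summed
over coordinates, even when the total norm is infinite. -/
theorem sum_dilationNormSq_convolution_le {G ι : Type*} [AddCommGroup G] [Fintype G]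
    (J : Finset ι) (a : ι → ℂ) (κ : ι → G) (φ : G → DilationSpace H) {C : ℝ≥0}
    (hC : ∀ χ : AddChar G ℂ, ‖∑ k ∈ J, a k * χ (κ k)‖ ≤ C) :
    ∑ g, dilationNormSq (∑ k ∈ J, a k • φ (g + κ k))
      ≤ (C : ℝ≥0∞) ^ 2 * ∑ g, dilationNormSq (φ g) := by
  simp only [dilationNormSq, Finset.sum_add_distrib, mul_add]
  refine add_le_add ?_ ?_
  · simpa [Prod.fst_sum] using AddChar.sum_enorm_sq_convolution_le J a κ (fun g => (φ g).1) hC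
  · rw [← Summable.tsum_finsetSum fun _ _ => ENNReal.summable,
      ← Summable.tsum_finsetSum fun _ _ => ENNReal.summable, ← ENNReal.tsum_mul_left]
    refine ENNReal.tsum_le_tsum fun i => ?_
    rw [Finset.sum_add_distrib, Finset.sum_add_distrib, mul_add]
    refine add_le_add ?_ ?_
    · simpa [Prod.snd_sum, Prod.fst_sum] using
        AddChar.sum_enorm_sq_convolution_le J a κ (fun g => ((φ g).2 i).1) hC
    · simpa [Prod.snd_sum] using
        AddChar.sum_enorm_sq_convolution_le J a κ (fun g => ((φ g).2 i).2) hC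

/-- **Ando's inequality**, up to a factor `2`, with the supremum over the torus replaced by a
maximum over a grid. -/
theorem enorm_sum_smul_pow_pow_le [CompleteSpace H] {ι : Type*} (T₁ T₂ : H →L[ℂ] H)
    (h₁ : ‖T₁‖ ≤ 1) (h₂ : ‖T₂‖ ≤ 1) (hT : Commute T₁ T₂) (J : Finset ι) (a : ι → ℂ)
    (p q : ι → ℕ) (D : ℕ) [NeZero D] (hp : ∀ k ∈ J, p k ≤ D) (hq : ∀ k ∈ J, q k ≤ D) {C : ℝ≥0}
    (hC : ∀ χ : AddChar (ZMod (2 * D) × ZMod (2 * D)) ℂ,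
      ‖∑ k ∈ J, a k * χ ((p k : ZMod (2 * D)), (q k : ZMod (2 * D)))‖ ≤ C) (h : H) :
    ‖∑ k ∈ J, a k • (T₁ ^ p k) ((T₂ ^ q k) h)‖ₑ ≤ 2 * C * ‖h‖ₑ := by
  obtain ⟨V₁, V₂, hV, hV₁, hV₂, hf₁, hf₂⟩ := exists_commuting_isometricLift T₁ T₂ h₁ h₂ hT
  have hD : 0 < D := Nat.pos_of_ne_zero (NeZero.ne D)
  have hV₁n : ∀ n x, dilationNormSq ((V₁ ^ n) x) = dilationNormSq x := fun n => by
    induction n with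
    | zero => exact fun x => rfl
    | succ n ih => exact fun x => by rw [pow_succ, Module.End.mul_apply, ih, hV₁]
  have hV₂n : ∀ n x, dilationNormSq ((V₂ ^ n) x) = dilationNormSq x := fun n => by
    induction n with
    | zero => exact fun x => rfl
    | succ n ih => exact fun x => by rw [pow_succ, Module.End.mul_apply, ih, hV₂]
  have hf₁n : ∀ n x, ((V₁ ^ n) x).1 = (T₁ ^ n) x.1 := fun n => by
    induction n with
    | zero => exact fun x => rfl
    | succ n ih =>
      intro x
      rw [pow_succ, Module.End.mul_apply, ih, hf₁, pow_succ]
      rfl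
  have hf₂n : ∀ n x, ((V₂ ^ n) x).1 = (T₂ ^ n) x.1 := fun n => by
    induction n with
    | zero => exact fun x => rfl
    | succ n ih =>
      intro x
      rw [pow_succ, Module.End.mul_apply, ih, hf₂, pow_succ]
      rfl
  let x₀ : DilationSpace H := (h, 0)
  have hx₀ : dilationNormSq x₀ = ‖h‖ₑ ^ 2 := by simp [dilationNormSq, x₀]
  let φ : ZMod (2 * D) × ZMod (2 * D) → DilationSpace H := fun g =>
    (V₁ ^ g.1.val) ((V₂ ^ g.2.val) x₀)
  have hφ : ∀ g, dilationNormSq (φ g) = ‖h‖ₑ ^ 2 := fun g => by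
    simp only [φ, hV₁n, hV₂n, hx₀]
  have hconv := sum_dilationNormSq_convolution_le J a
    (fun k => ((p k : ZMod (2 * D)), (q k : ZMod (2 * D)))) φ hC
  simp only [hφ, Finset.sum_const, Finset.card_univ, Fintype.card_prod, ZMod.card,
    nsmul_eq_mul] at hconv
  set v := ‖∑ k ∈ J, a k • (T₁ ^ p k) ((T₂ ^ q k) h)‖ₑ with hv
  -- For `r, s < D` and exponents at most `D` nothing wraps around modulo `2 * D`, so the
  -- convolution at `(r, s)` is the image of the wanted sum under `V₁ ^ r` and `V₂ ^ s`, and its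
  -- first component at `r = s = 0` is the sum for `T₁`, `T₂`.
  have hlow : ∀ r < D, ∀ s < D, v ^ 2 ≤ dilationNormSq (∑ k ∈ J, a k •
      φ (((r : ℕ) : ZMod (2 * D)) + (p k : ZMod (2 * D)), (s : ZMod (2 * D)) + (q k : ZMod (2 * D)))) := by
    intro r hr s hs
    have hval : ∀ m ≤ D, ∀ t < D, ((t : ZMod (2 * D)) + (m : ZMod (2 * D))).val = t + m := by
      intro m hm t ht
      rw [← Nat.cast_add, ZMod.val_natCast, Nat.mod_eq_of_lt (by omega)]
    have e : ∑ k ∈ J, a k •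
        φ (((r : ℕ) : ZMod (2 * D)) + (p k : ZMod (2 * D)), (s : ZMod (2 * D)) + (q k : ZMod (2 * D)))
        = (V₁ ^ r) ((V₂ ^ s) (∑ k ∈ J, a k • (V₁ ^ p k) ((V₂ ^ q k) x₀))) := by
      simp only [map_sum, map_smul]
      refine Finset.sum_congr rfl fun k hk => ?_
      simp only [φ]
      rw [hval _ (hp k hk) r hr, hval _ (hq k hk) s hs]
      simp only [← Module.End.mul_apply]
      congr 2
      rw [pow_add, pow_add, mul_assoc, (hV.pow_pow (p k) s).left_comm]
    rw [e, hV₁n, hV₂n]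
    refine le_trans (le_of_eq ?_) le_self_add
    rw [hv, Prod.fst_sum]
    simp [hf₁n, hf₂n, x₀]
  -- Only `D²` of the `(2D)²` grid points are used; this ratio of 4 is the factor 2 in the norm.
  have hinj : ((D : ℝ≥0∞) * D) * v ^ 2 ≤ ((D : ℝ≥0∞) * D) * (2 * C * ‖h‖ₑ) ^ 2 := by
    calc ((D : ℝ≥0∞) * D) * v ^ 2
        = ∑ rs ∈ Finset.range D ×ˢ Finset.range D, v ^ 2 := by
          simp [Finset.sum_const, Finset.card_product]
      _ ≤ ∑ rs ∈ Finset.range D ×ˢ Finset.range D, dilationNormSq (∑ k ∈ J, a k •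
            φ (((rs.1 : ZMod (2 * D)), (rs.2 : ZMod (2 * D)))
              + ((p k : ZMod (2 * D)), (q k : ZMod (2 * D))))) := by
          refine Finset.sum_le_sum fun rs hrs => ?_
          rw [Finset.mem_product, Finset.mem_range, Finset.mem_range] at hrs
          exact hlow _ hrs.1 _ hrs.2
      _ = ∑ g ∈ (Finset.range D ×ˢ Finset.range D).image
            (fun rs : ℕ × ℕ => ((rs.1 : ZMod (2 * D)), (rs.2 : ZMod (2 * D)))),
            dilationNormSq (∑ k ∈ J, a k •
              φ (g + ((p k : ZMod (2 * D)), (q k : ZMod (2 * D))))) := by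
          rw [Finset.sum_image]
          rintro ⟨r, s⟩ hrs ⟨r', s'⟩ hrs' heq
          simp only [Finset.coe_product, Finset.coe_range, Set.mem_prod, Set.mem_Iio] at hrs hrs'
          rw [Prod.mk.injEq, ZMod.natCast_eq_natCast_iff', ZMod.natCast_eq_natCast_iff',
            Nat.mod_eq_of_lt (by omega), Nat.mod_eq_of_lt (by omega),
            Nat.mod_eq_of_lt (by omega), Nat.mod_eq_of_lt (by omega)] at heq
          exact Prod.ext heq.1 heq.2
      _ ≤ ∑ g, dilationNormSq (∑ k ∈ J, a k •
            φ (g + ((p k : ZMod (2 * D)), (q k : ZMod (2 * D))))) :=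
          Finset.sum_le_sum_of_subset (Finset.subset_univ _)
      _ ≤ _ := hconv
      _ = _ := by push_cast; ring
  have hD0 : ((D : ℝ≥0∞) * D) ≠ 0 := by
    simp [NeZero.ne D]
  have := (ENNReal.mul_le_mul_iff_right hD0 (by finiteness)).1 hinj
  exact (ENNReal.pow_right_strictMono two_ne_zero).le_iff_le.1 this

end Ando

/-! ### Maxima of Rademacher sums -/

section Rademacher

variable {ι ζ : Type*} [DecidableEq ι]

/-- A subset `A` encodes the signs `+` on `A` and `-` on `J \ A`; the sum factors into hyperbolic
cosines. -/
theorem sum_powerset_exp_le (J : Finset ι) (c : ι → ℝ) :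
    ∑ A ∈ J.powerset, Real.exp (∑ k ∈ A, c k - ∑ k ∈ J \ A, c k)
      ≤ 2 ^ J.card * Real.exp ((∑ k ∈ J, c k ^ 2) / 2) := by
  have h : ∑ A ∈ J.powerset, Real.exp (∑ k ∈ A, c k - ∑ k ∈ J \ A, c k)
      = ∏ k ∈ J, (Real.exp (c k) + Real.exp (-c k)) := by
    rw [Finset.prod_add]
    refine Finset.sum_congr rfl fun A _ => ?_
    rw [← Real.exp_sum, ← Real.exp_sum, ← Real.exp_add, Finset.sum_neg_distrib, sub_eq_add_neg]
  rw [h, Finset.sum_div, Real.exp_sum, ← Finset.prod_const, ← Finset.prod_mul_distrib]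
  refine Finset.prod_le_prod (fun k _ => by positivity) fun k _ => ?_
  have := Real.cosh_le_exp_half_sq (c k)
  rw [Real.cosh_eq] at this
  linarith

/-- Beyond `4 * L` one has `v - 2 * L ≥ v / 2`, and `exp (v / 2) ≥ v ^ 2 / 8`. -/
theorem sq_le_add_exp {v : ℝ} (hv : 0 ≤ v) (L : ℝ) :
    v ^ 2 ≤ 16 * L ^ 2 + 8 * (Real.exp v * Real.exp (-(2 * L))) := by
  rw [← Real.exp_add]
  rcases le_total v (4 * L) with h | h
  · have : v ^ 2 ≤ (4 * L) ^ 2 := by gcongr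
    have := Real.exp_pos (v + -(2 * L))
    linarith
  · have h1 := Real.quadratic_le_exp_of_nonneg (x := v / 2) (by positivity)
    have h2 : Real.exp (v / 2) ≤ Real.exp (v + -(2 * L)) := Real.exp_le_exp.2 (by linarith)
    nlinarith [sq_nonneg L]

/-- The mean square of a maximum of `N` Rademacher sums is at most `O(log N)` times the largest
variance. -/
theorem sum_powerset_sq_le [Fintype ζ] [Nonempty ζ] (J : Finset ι) (c : ζ → ι → ℝ) {s : ℝ}
    (hs : ∀ z, ∑ k ∈ J, c z k ^ 2 ≤ s) (z : Finset ι → ζ) :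
    ∑ A ∈ J.powerset, (∑ k ∈ A, c (z A) k - ∑ k ∈ J \ A, c (z A) k) ^ 2
      ≤ 2 ^ J.card * (17 * Real.log (2 * Fintype.card ζ) * s) := by
  set N : ℝ := ((Fintype.card ζ : ℕ) : ℝ) with hN
  have hN1 : 1 ≤ N := by rw [hN]; exact_mod_cast Fintype.card_pos
  set L := Real.log (2 * N) with hL
  have hL2 : Real.log 2 ≤ L := Real.log_le_log (by norm_num) (by linarith)
  have hlog2 := Real.log_two_gt_d9
  have hL0 : 0 < L := by linarith
  have hs0 : 0 ≤ s := (Finset.sum_nonneg fun k _ => sq_nonneg _).trans (hs (z ∅))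
  rcases hs0.eq_or_lt with rfl | hs0
  · have h0 : ∀ z, ∀ k ∈ J, c z k = 0 := fun z k hk => by
      have := (Finset.sum_eq_zero_iff_of_nonneg fun k _ => sq_nonneg (c z k)).1
        (le_antisymm (hs z) (Finset.sum_nonneg fun k _ => sq_nonneg _)) k hk
      exact pow_eq_zero_iff two_ne_zero |>.1 this
    rw [mul_zero, mul_zero]
    refine (Finset.sum_eq_zero fun A hA => ?_).le
    rw [Finset.sum_eq_zero fun k hk => h0 (z A) k (Finset.mem_powerset.1 hA hk),
      Finset.sum_eq_zero fun k hk => h0 (z A) k (Finset.mem_sdiff.1 hk).1]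
    simp
  -- Chosen so that `exp (t ^ 2 * s / 2) = 2 * N`. Summing over `N` coordinates and two signs gives
  -- `(2 * N) ^ 2`, which `exp (-(2 * L))` cancels.
  set t := Real.sqrt (2 * L / s) with ht
  have ht2 : t ^ 2 = 2 * L / s := Real.sq_sqrt (by positivity)
  have ht0 : 0 ≤ t := Real.sqrt_nonneg _
  have htpos : 0 < t ^ 2 := by rw [ht2]; positivity
  let S : Finset ι → ζ → ℝ := fun A y => ∑ k ∈ A, c y k - ∑ k ∈ J \ A, c y k
  have hexp : ∀ (ε : ℝ), ε ^ 2 = 1 → ∀ y, ∑ A ∈ J.powerset, Real.exp (ε * t * S A y)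
      ≤ 2 ^ J.card * (2 * N) := by
    intro ε hε y
    have h := sum_powerset_exp_le J fun k => ε * t * c y k
    simp only [← Finset.mul_sum, ← mul_sub, mul_pow, hε, one_mul] at h
    refine h.trans ?_
    gcongr
    rw [ht2, ← Real.exp_log (show (0 : ℝ) < 2 * N by linarith)]
    refine Real.exp_le_exp.2 ?_
    rw [← hL]
    have := hs y
    rw [div_mul_eq_mul_div, div_div, div_le_iff₀ (by positivity)]
    nlinarith
  have hpt : ∀ A, t ^ 2 * S A (z A) ^ 2 ≤ 16 * L ^ 2 + 8 * ((∑ y, (Real.exp (1 * t * S A y)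
      + Real.exp ((-1) * t * S A y))) * Real.exp (-(2 * L))) := by
    intro A
    have h1 := sq_le_add_exp (v := |t * S A (z A)|) (abs_nonneg _) L
    rw [sq_abs, mul_pow] at h1
    have h2 : Real.exp |t * S A (z A)| ≤ ∑ y, (Real.exp (1 * t * S A y)
      + Real.exp ((-1) * t * S A y)) := by
      refine le_trans ?_ (Finset.single_le_sum (f := fun y => Real.exp (1 * t * S A y)
        + Real.exp ((-1) * t * S A y)) (fun y _ => by positivity) (Finset.mem_univ (z A)))
      have e1 : 1 * t * S A (z A) = t * S A (z A) := by ring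
      have e2 : (-1) * t * S A (z A) = -(t * S A (z A)) := by ring
      rw [e1, e2]
      rcases abs_cases (t * S A (z A)) with ⟨h, _⟩ | ⟨h, _⟩ <;> rw [h] <;>
        linarith [Real.exp_pos (t * S A (z A)), Real.exp_pos (-(t * S A (z A)))]
    have h3 := mul_le_mul_of_nonneg_right h2 (Real.exp_pos (-(2 * L))).le
    linarith
  have hsum : t ^ 2 * ∑ A ∈ J.powerset, S A (z A) ^ 2 ≤ 2 ^ J.card * (16 * L ^ 2 + 8) := by
    rw [Finset.mul_sum]
    refine (Finset.sum_le_sum fun A _ => hpt A).trans ?_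
    rw [Finset.sum_add_distrib, Finset.sum_const, ← Finset.mul_sum, ← Finset.sum_mul,
      Finset.sum_comm]
    have hb : ∑ y : ζ, ∑ A ∈ J.powerset, (Real.exp (1 * t * S A y)
        + Real.exp ((-1) * t * S A y)) ≤ 2 ^ J.card * (2 * N) ^ 2 := by
      calc _ ≤ ∑ y : ζ, (2 ^ J.card * (2 * N) + 2 ^ J.card * (2 * N)) := by
            refine Finset.sum_le_sum fun y _ => ?_
            rw [Finset.sum_add_distrib]
            exact add_le_add (hexp 1 (by norm_num) y) (hexp (-1) (by norm_num) y)
        _ = _ := by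
            rw [Finset.sum_const, Finset.card_univ, nsmul_eq_mul, ← hN]
            ring
    have he : Real.exp (-(2 * L)) = ((2 * N) ^ 2)⁻¹ := by
      rw [Real.exp_neg, two_mul L, Real.exp_add, hL, Real.exp_log (by linarith), sq (2 * N)]
    rw [he]
    have hN2 : (0 : ℝ) < (2 * N) ^ 2 := by positivity
    have := mul_le_mul_of_nonneg_right hb (inv_nonneg.2 hN2.le)
    rw [mul_assoc, mul_inv_cancel₀ hN2.ne', mul_one] at this
    simp only [Finset.card_powerset, nsmul_eq_mul]
    push_cast
    linarith
  have hfin : ∑ A ∈ J.powerset, S A (z A) ^ 2 ≤ 2 ^ J.card * (16 * L ^ 2 + 8) / t ^ 2 := by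
    rw [le_div_iff₀ htpos, mul_comm]
    exact hsum
  refine hfin.trans ?_
  rw [mul_div_assoc]
  gcongr
  rw [ht2, div_div_eq_mul_div, div_le_iff₀ (by positivity)]
  have : 16 * L ^ 2 + 8 ≤ 34 * L ^ 2 := by nlinarith
  nlinarith

/-- The coordinate attaining the sup norm may depend on the signs, which the function `z` of
`sum_powerset_sq_le` allows. Real and imaginary parts cost 17 each. -/
theorem sum_powerset_norm_sq_le [Fintype ζ] [Nonempty ζ] (J : Finset ι) (w : ι → ζ → ℂ)
    (b : ι → ℝ) (hw : ∀ k z, ‖w k z‖ ≤ b k) :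
    ∑ A ∈ J.powerset, ‖∑ k ∈ A, w k - ∑ k ∈ J \ A, w k‖ ^ 2
      ≤ 2 ^ J.card * (34 * Real.log (2 * Fintype.card ζ) * ∑ k ∈ J, b k ^ 2) := by
  have hmax : ∀ x : ζ → ℂ, ∃ z, ‖x‖ ≤ ‖x z‖ := fun x => by
    obtain ⟨z, hz⟩ := Finite.exists_max fun z => ‖x z‖
    exact ⟨z, (pi_norm_le_iff_of_nonneg (norm_nonneg _)).2 hz⟩
  choose z hz using fun A : Finset ι => hmax (∑ k ∈ A, w k - ∑ k ∈ J \ A, w k)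
  have hre : ∀ y, ∑ k ∈ J, (w k y).re ^ 2 ≤ ∑ k ∈ J, b k ^ 2 := fun y =>
    Finset.sum_le_sum fun k _ => sq_le_sq' (by
      linarith [neg_abs_le (w k y).re, Complex.abs_re_le_norm (w k y), hw k y])
      ((Complex.re_le_norm _).trans (hw k y))
  have him : ∀ y, ∑ k ∈ J, (w k y).im ^ 2 ≤ ∑ k ∈ J, b k ^ 2 := fun y =>
    Finset.sum_le_sum fun k _ => sq_le_sq' (by
      linarith [neg_abs_le (w k y).im, Complex.abs_im_le_norm (w k y), hw k y])
      ((Complex.im_le_norm _).trans (hw k y))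
  have h1 := sum_powerset_sq_le J (fun y k => (w k y).re) hre z
  have h2 := sum_powerset_sq_le J (fun y k => (w k y).im) him z
  have h3 : ∑ A ∈ J.powerset, ‖∑ k ∈ A, w k - ∑ k ∈ J \ A, w k‖ ^ 2
      ≤ ∑ A ∈ J.powerset, ((∑ k ∈ A, (w k (z A)).re - ∑ k ∈ J \ A, (w k (z A)).re) ^ 2
        + (∑ k ∈ A, (w k (z A)).im - ∑ k ∈ J \ A, (w k (z A)).im) ^ 2) := by
    refine Finset.sum_le_sum fun A _ => ?_
    have := pow_le_pow_left₀ (norm_nonneg _) (hz A) 2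
    refine this.trans (le_of_eq ?_)
    rw [Complex.sq_norm, Complex.normSq_apply]
    simp only [Pi.sub_apply, Finset.sum_apply, Complex.sub_re, Complex.sub_im, Complex.re_sum,
      Complex.im_sum]
    ring
  rw [Finset.sum_add_distrib] at h3
  linarith

end Rademacher

/-! ### Symmetrization and type 2 inequalities -/

section TypeTwo

variable {Ω : Type*} [MeasurableSpace Ω] {μ : Measure Ω} [IsProbabilityMeasure μ]

theorem enorm_add_sq_le {E : Type*} [SeminormedAddCommGroup E] (x y : E) :
    ‖x + y‖ₑ ^ 2 ≤ 2 * ‖x‖ₑ ^ 2 + 2 * ‖y‖ₑ ^ 2 := by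
  have h : ‖x + y‖₊ ^ 2 ≤ 2 * ‖x‖₊ ^ 2 + 2 * ‖y‖₊ ^ 2 := by
    rw [← NNReal.coe_le_coe]
    push_cast
    have := pow_le_pow_left₀ (norm_nonneg _) (norm_add_le x y) 2
    nlinarith [sq_nonneg (‖x‖ - ‖y‖)]
  simp only [enorm_eq_nnnorm]
  exact_mod_cast h

theorem enorm_integral_sq_le {E : Type*} [NormedAddCommGroup E] [NormedSpace ℝ E]
    {f : Ω → E} (hf : AEStronglyMeasurable f μ) :
    ‖∫ ω, f ω ∂μ‖ₑ ^ 2 ≤ ∫⁻ ω, ‖f ω‖ₑ ^ 2 ∂μ := by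
  have h1 : ‖∫ ω, f ω ∂μ‖ₑ ≤ eLpNorm f 2 μ :=
    (enorm_integral_le_lintegral_enorm f).trans
      (by rw [← eLpNorm_one_eq_lintegral_enorm]
          exact eLpNorm_le_eLpNorm_of_exponent_le (by norm_num) hf)
  have h2 : ‖∫ ω, f ω ∂μ‖ₑ ^ 2 ≤ eLpNorm f 2 μ ^ 2 := by gcongr
  refine h2.trans (le_of_eq ?_)
  have := eLpNorm_nnreal_pow_eq_lintegral (f := f) (μ := μ) (p := 2) two_ne_zero
  simpa using this

/-- Adding an independent centered variable does not decrease the second moment. -/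
theorem lintegral_enorm_sq_le_add {E : Type*} [NormedAddCommGroup E] [NormedSpace ℝ E]
    [CompleteSpace E] [MeasurableSpace E] [BorelSpace E] [SecondCountableTopology E]
    {U V : Ω → E} (hU : Measurable U) (hV : Measurable V) (hUV : IndepFun U V μ)
    (hVi : Integrable V μ) (hV0 : ∫ ω, V ω ∂μ = 0) :
    ∫⁻ ω, ‖U ω‖ₑ ^ 2 ∂μ ≤ ∫⁻ ω, ‖U ω + V ω‖ₑ ^ 2 ∂μ := by
  have : IsProbabilityMeasure (μ.map U) := Measure.isProbabilityMeasure_map hU.aemeasurable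
  have : IsProbabilityMeasure (μ.map V) := Measure.isProbabilityMeasure_map hV.aemeasurable
  have h := (indepFun_iff_map_prod_eq_prod_map_map hU.aemeasurable hV.aemeasurable).1 hUV
  have hm : Measurable fun x : E × E => ‖x.1 + x.2‖ₑ ^ 2 :=
    ((measurable_fst.add measurable_snd).enorm).pow_const 2
  have e1 : ∫⁻ ω, ‖U ω + V ω‖ₑ ^ 2 ∂μ
      = ∫⁻ x, ∫⁻ y, ‖x + y‖ₑ ^ 2 ∂(μ.map V) ∂(μ.map U) := by
    rw [← lintegral_prod _ hm.aemeasurable, ← h, lintegral_map hm (hU.prodMk hV)]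
  have e2 : ∫⁻ ω, ‖U ω‖ₑ ^ 2 ∂μ = ∫⁻ x, ‖x‖ₑ ^ 2 ∂(μ.map U) := by
    rw [lintegral_map (measurable_enorm.pow_const 2) hU]
  rw [e1, e2]
  -- Jensen with `U = x` frozen: `x` is the mean of `x + V`.
  refine lintegral_mono fun x => ?_
  have hi : Integrable (fun y : E => y) (μ.map V) :=
    (integrable_map_measure aestronglyMeasurable_id hV.aemeasurable).2 hVi
  have hint : ∫ y, x + y ∂(μ.map V) = x := by
    rw [integral_add (integrable_const x) hi,
      integral_map (f := fun y : E => y) hV.aemeasurable aestronglyMeasurable_id, hV0]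
    simp
  have := enorm_integral_sq_le (μ := μ.map V) (f := fun y => x + y)
    ((integrable_const x).add hi).aestronglyMeasurable
  rwa [hint] at this

variable {ι ζ : Type*}

/-- A type 2 inequality in the space of functions on a finite set, with the logarithmic constant,
for a centered independent sequence. -/
theorem lintegral_enorm_sum_smul_sq_le [Fintype ζ] [Nonempty ζ] {X : ι → Ω → ℂ}
    (hm : ∀ k, Measurable (X k)) (hL2 : ∀ k, MemLp (X k) 2 μ) (h0 : ∀ k, ∫ ω, X k ω ∂μ = 0)
    (hX : iIndepFun X μ) (w : ι → ζ → ℂ) (hw : ∀ k z, ‖w k z‖ ≤ 1) (J : Finset ι) :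
    ∫⁻ ω, ‖∑ k ∈ J, X k ω • w k‖ₑ ^ 2 ∂μ
      ≤ ENNReal.ofReal (136 * Real.log (2 * Fintype.card ζ))
        * ∑ k ∈ J, ∫⁻ ω, ‖X k ω‖ₑ ^ 2 ∂μ := by
  classical
  let S : Finset ι → Ω → ζ → ℂ := fun A ω => ∑ k ∈ A, X k ω • w k
  have hSm : ∀ A, Measurable (S A) := fun A =>
    Finset.measurable_fun_sum _ fun k _ => (hm k).smul_const (w k)
  have hXi : ∀ k, Integrable (X k) μ := fun k => (hL2 k).integrable (by norm_num)
  have hSi : ∀ A, Integrable (S A) μ := fun A =>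
    integrable_finsetSum _ fun k _ => (hXi k).smul_const (w k)
  have hS0 : ∀ A, ∫ ω, S A ω ∂μ = 0 := fun A => by
    rw [integral_finsetSum _ fun k _ => (hXi k).smul_const (w k)]
    refine Finset.sum_eq_zero fun k _ => ?_
    rw [integral_smul_const, h0, zero_smul]
  have hind : ∀ A B, Disjoint A B → IndepFun (S A) (S B) μ := fun A B hAB => by
    have h := hX.indepFun_finset A B hAB hm
    have hg : ∀ A : Finset ι, Measurable fun x : A → ℂ => ∑ k : A, x k • w k := fun A =>
      Finset.measurable_fun_sum _ fun k _ => (measurable_pi_apply k).smul_const (w k)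
    have hc := h.comp (hg A) (hg B)
    have e : ∀ A : Finset ι, (fun x : A → ℂ => ∑ k : A, x k • w k) ∘ (fun ω (k : A) => X k ω)
        = S A := fun A => funext fun ω => by
      simp only [Function.comp_apply, S]
      exact Finset.sum_coe_sort A fun k => X k ω • w k
    rwa [e, e] at hc
  have hle : ∀ A B, Disjoint A B →
      ∫⁻ ω, ‖S A ω‖ₑ ^ 2 ∂μ ≤ ∫⁻ ω, ‖S A ω - S B ω‖ₑ ^ 2 ∂μ := fun A B hAB => by
    simp only [sub_eq_add_neg]
    refine lintegral_enorm_sq_le_add (V := fun ω => -S B ω) (hSm A) (hSm B).neg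
      ((hind A B hAB).comp measurable_id measurable_neg) (hSi B).neg ?_
    rw [integral_neg, hS0, neg_zero]
  -- Symmetrization for a fixed choice of signs: each half of the sum is dominated by the signed
  -- sum, because the other half is independent and centered. Averaging over `A` then brings in the
  -- Rademacher bound for each `ω`.
  have hA : ∀ A ∈ J.powerset,
      ∫⁻ ω, ‖S J ω‖ₑ ^ 2 ∂μ ≤ 4 * ∫⁻ ω, ‖S A ω - S (J \ A) ω‖ₑ ^ 2 ∂μ := fun A hA => by
    have hd : Disjoint A (J \ A) := Finset.disjoint_sdiff
    have e : ∀ ω, S J ω = S A ω + S (J \ A) ω := fun ω => by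
      simp only [S]
      rw [add_comm, Finset.sum_sdiff (Finset.mem_powerset.1 hA)]
    have h2 : ∫⁻ ω, ‖S (J \ A) ω‖ₑ ^ 2 ∂μ ≤ ∫⁻ ω, ‖S A ω - S (J \ A) ω‖ₑ ^ 2 ∂μ := by
      refine (hle _ _ hd.symm).trans (le_of_eq ?_)
      simp only [← enorm_neg (S A _ - _), neg_sub]
    calc ∫⁻ ω, ‖S J ω‖ₑ ^ 2 ∂μ
        ≤ ∫⁻ ω, (2 * ‖S A ω‖ₑ ^ 2 + 2 * ‖S (J \ A) ω‖ₑ ^ 2) ∂μ :=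
          lintegral_mono fun ω => by rw [e ω]; exact enorm_add_sq_le _ _
      _ = 2 * ∫⁻ ω, ‖S A ω‖ₑ ^ 2 ∂μ + 2 * ∫⁻ ω, ‖S (J \ A) ω‖ₑ ^ 2 ∂μ := by
          rw [lintegral_add_left (((hSm A).enorm.pow_const 2).const_mul 2),
            lintegral_const_mul _ ((hSm A).enorm.pow_const 2),
            lintegral_const_mul _ ((hSm _).enorm.pow_const 2)]
      _ ≤ 2 * ∫⁻ ω, ‖S A ω - S (J \ A) ω‖ₑ ^ 2 ∂μ
            + 2 * ∫⁻ ω, ‖S A ω - S (J \ A) ω‖ₑ ^ 2 ∂μ := by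
          exact add_le_add (mul_le_mul_right (hle _ _ hd) 2) (mul_le_mul_right h2 2)
      _ = _ := by rw [← add_mul]; norm_num
  have hpt : ∀ ω, ∑ A ∈ J.powerset, ‖S A ω - S (J \ A) ω‖ₑ ^ 2
      ≤ 2 ^ J.card * (ENNReal.ofReal (34 * Real.log (2 * Fintype.card ζ))
        * ∑ k ∈ J, ‖X k ω‖ₑ ^ 2) := fun ω => by
    have h := sum_powerset_norm_sq_le J (fun k => X k ω • w k) (fun k => ‖X k ω‖) fun k z => by
      simpa using mul_le_of_le_one_right (norm_nonneg (X k ω)) (hw k z)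
    have hlog : 0 ≤ 34 * Real.log (2 * Fintype.card ζ) := by
      have : (1 : ℝ) ≤ Fintype.card ζ := by exact_mod_cast Fintype.card_pos
      exact mul_nonneg (by norm_num) (Real.log_nonneg (by linarith))
    have h' := ENNReal.ofReal_le_ofReal h
    rw [ENNReal.ofReal_sum_of_nonneg fun _ _ => by positivity, ENNReal.ofReal_mul (by positivity),
      ENNReal.ofReal_mul hlog, ENNReal.ofReal_sum_of_nonneg fun _ _ => by positivity,
      ENNReal.ofReal_pow (by norm_num)] at h'
    simpa only [ENNReal.ofReal_pow (norm_nonneg _), ofReal_norm, ENNReal.ofReal_ofNat] using h'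
  have hmain : (2 : ℝ≥0∞) ^ J.card * ∫⁻ ω, ‖S J ω‖ₑ ^ 2 ∂μ
      ≤ 2 ^ J.card * (ENNReal.ofReal (136 * Real.log (2 * Fintype.card ζ))
        * ∑ k ∈ J, ∫⁻ ω, ‖X k ω‖ₑ ^ 2 ∂μ) := by
    calc (2 : ℝ≥0∞) ^ J.card * ∫⁻ ω, ‖S J ω‖ₑ ^ 2 ∂μ
        = ∑ A ∈ J.powerset, ∫⁻ ω, ‖S J ω‖ₑ ^ 2 ∂μ := by
          rw [Finset.sum_const, Finset.card_powerset, nsmul_eq_mul]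
          push_cast
          rfl
      _ ≤ ∑ A ∈ J.powerset, 4 * ∫⁻ ω, ‖S A ω - S (J \ A) ω‖ₑ ^ 2 ∂μ := Finset.sum_le_sum hA
      _ = 4 * ∫⁻ ω, ∑ A ∈ J.powerset, ‖S A ω - S (J \ A) ω‖ₑ ^ 2 ∂μ := by
          rw [← Finset.mul_sum, lintegral_finsetSum (f := fun A ω => ‖S A ω - S (J \ A) ω‖ₑ ^ 2) _
            fun A _ => (((hSm A).sub (hSm (J \ A))).enorm.pow_const 2)]
      _ ≤ 4 * ∫⁻ ω, 2 ^ J.card * (ENNReal.ofReal (34 * Real.log (2 * Fintype.card ζ))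
            * ∑ k ∈ J, ‖X k ω‖ₑ ^ 2) ∂μ := by
          gcongr with ω
          exact hpt ω
      _ = _ := by
          have hmk : ∀ k ∈ J, Measurable fun ω => ‖X k ω‖ₑ ^ 2 := fun k _ =>
            (hm k).enorm.pow_const 2
          rw [lintegral_const_mul _ ((Finset.measurable_fun_sum _ hmk).const_mul _),
            lintegral_const_mul _ (Finset.measurable_fun_sum _ hmk), lintegral_finsetSum _ hmk,
            show (136 : ℝ) = 4 * 34 by norm_num, mul_assoc (4 : ℝ),
            ENNReal.ofReal_mul (by norm_num : (0 : ℝ) ≤ 4), ENNReal.ofReal_ofNat]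
          ring
  exact (ENNReal.mul_le_mul_iff_right (by positivity) (by finiteness)).1 hmain

omit [IsProbabilityMeasure μ] in
/-- The second moment bound for a random sum given by the Cauchy–Schwarz inequality. -/
theorem lintegral_enorm_sum_smul_sq_le_card [Fintype ζ] {X : ι → Ω → ℂ}
    (hm : ∀ k, Measurable (X k)) (w : ι → ζ → ℂ) (hw : ∀ k z, ‖w k z‖ ≤ 1) (J : Finset ι) :
    ∫⁻ ω, ‖∑ k ∈ J, X k ω • w k‖ₑ ^ 2 ∂μ ≤ J.card * ∑ k ∈ J, ∫⁻ ω, ‖X k ω‖ₑ ^ 2 ∂μ := by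
  have hmk : ∀ k ∈ J, Measurable fun ω => ‖X k ω‖ₑ ^ 2 := fun k _ => (hm k).enorm.pow_const 2
  rw [← lintegral_finsetSum _ hmk, ← lintegral_const_mul _ (Finset.measurable_fun_sum _ hmk)]
  refine lintegral_mono fun ω => ?_
  have h : ‖∑ k ∈ J, X k ω • w k‖₊ ^ 2 ≤ J.card * ∑ k ∈ J, ‖X k ω‖₊ ^ 2 := by
    rw [← NNReal.coe_le_coe]
    push_cast
    have h1 : ‖∑ k ∈ J, X k ω • w k‖ ≤ ∑ k ∈ J, ‖X k ω‖ := by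
      refine norm_sum_le_of_le _ fun k _ => ?_
      rw [norm_smul]
      exact mul_le_of_le_one_right (norm_nonneg _)
        ((pi_norm_le_iff_of_nonneg zero_le_one).2 (hw k))
    exact (pow_le_pow_left₀ (norm_nonneg _) h1 2).trans sq_sum_le_card_mul_sum_sq
  simp only [enorm_eq_nnnorm]
  exact_mod_cast h

end TypeTwo

/-! ### Dyadic decomposition and weighted Cauchy–Schwarz -/

section RademacherMenshov

/-- A partial sum is a sum of at most one dyadic block from each scale. -/
theorem norm_sum_filter_lt_le {ι E : Type*} [NormedAddCommGroup E] (B : Finset ι) (e : ι → ℕ)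
    (x : ι → E) (n M : ℕ) (hn : n < 2 ^ M) :
    ‖∑ k ∈ B with e k < n, x k‖
      ≤ ∑ l ∈ Finset.range M, ‖∑ k ∈ B with e k / 2 ^ l = n / 2 ^ l - 1, x k‖ := by
  classical
  have h : ∀ N, ‖∑ k ∈ B with e k < n, x k‖ ≤ ‖∑ k ∈ B with e k / 2 ^ N < n / 2 ^ N, x k‖
      + ∑ l ∈ Finset.range N, ‖∑ k ∈ B with e k / 2 ^ l = n / 2 ^ l - 1, x k‖ := by
    intro N
    induction N with
    | zero => simp
    | succ N ih =>
      refine ih.trans ?_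
      rw [Finset.sum_range_succ, add_comm (Finset.sum _ _) (norm _), ← add_assoc]
      gcongr
      have hdiv : ∀ a : ℕ, a / 2 ^ (N + 1) = a / 2 ^ N / 2 := fun a => by
        rw [pow_succ, Nat.div_div_eq_div_mul]
      -- Binary digit of `n` at scale `N`: a digit 0 removes nothing, a digit 1 removes the last
      -- block. The bound includes a block at every scale, which only enlarges it.
      rcases Nat.even_or_odd' (n / 2 ^ N) with ⟨c, hc | hc⟩
      · have : (B.filter fun k => e k / 2 ^ N < n / 2 ^ N)
            = B.filter fun k => e k / 2 ^ (N + 1) < n / 2 ^ (N + 1) := by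
          refine Finset.filter_congr fun k _ => ?_
          rw [hdiv, hdiv, hc]
          omega
        rw [this]
        exact le_add_of_nonneg_right (norm_nonneg _)
      · have hd : Disjoint (B.filter fun k => e k / 2 ^ (N + 1) < n / 2 ^ (N + 1))
            (B.filter fun k => e k / 2 ^ N = n / 2 ^ N - 1) := by
          rw [Finset.disjoint_filter]
          intro k _
          rw [hdiv, hdiv, hc]
          omega
        have : (B.filter fun k => e k / 2 ^ N < n / 2 ^ N)
            = (B.filter fun k => e k / 2 ^ (N + 1) < n / 2 ^ (N + 1)).disjUnion
              (B.filter fun k => e k / 2 ^ N = n / 2 ^ N - 1) hd := by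
          rw [Finset.disjUnion_eq_union, ← Finset.filter_or]
          refine Finset.filter_congr fun k _ => ?_
          rw [hdiv, hdiv, hc]
          omega
        rw [this, Finset.sum_disjUnion]
        exact norm_add_le _ _
  have h1 := h M
  simpa [Nat.div_eq_of_lt hn] using h1

/-- The pointwise Rademacher–Menshov inequality. -/
theorem enorm_sum_filter_lt_sq_le {ι E : Type*} [NormedAddCommGroup E] (B : Finset ι)
    (e : ι → ℕ) (x : ι → E) (n M : ℕ) (hB : ∀ k ∈ B, e k < 2 ^ M) :
    ‖∑ k ∈ B with e k < n, x k‖ₑ ^ 2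
      ≤ (M + 1) * ∑ l ∈ Finset.range (M + 1), ∑ i ∈ Finset.range (2 ^ M),
        ‖∑ k ∈ B with e k / 2 ^ l = i, x k‖ₑ ^ 2 := by
  wlog hn : n ≤ 2 ^ M generalizing n with key
  · have : (B.filter fun k => e k < n) = B.filter fun k => e k < 2 ^ M :=
      Finset.filter_congr fun k hk => by
        have := hB k hk
        constructor <;> intro <;> omega
    rw [this]
    exact key _ le_rfl
  have h := norm_sum_filter_lt_le B e x n (M + 1) (by rw [pow_succ]; have := Nat.two_pow_pos M; omega)
  have h2 : ‖∑ k ∈ B with e k < n, x k‖₊ ^ 2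
      ≤ (M + 1) * ∑ l ∈ Finset.range (M + 1), ∑ i ∈ Finset.range (2 ^ M),
        ‖∑ k ∈ B with e k / 2 ^ l = i, x k‖₊ ^ 2 := by
    rw [← NNReal.coe_le_coe]
    push_cast
    refine (pow_le_pow_left₀ (norm_nonneg _) h 2).trans (sq_sum_le_card_mul_sum_sq.trans ?_)
    rw [Finset.card_range]
    push_cast
    gcongr with l hl
    refine Finset.single_le_sum (f := fun i => ‖∑ k ∈ B with e k / 2 ^ l = i, x k‖ ^ 2)
      (fun i _ => sq_nonneg _) (Finset.mem_range.2 ?_)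
    have := Nat.div_le_self n (2 ^ l)
    have := Nat.two_pow_pos M
    omega
  simp only [enorm_eq_nnnorm]
  exact_mod_cast h2

/-- Cauchy–Schwarz against `1 / (m + 1)`, whose squares sum to at most 2 by telescoping. -/
theorem sq_sum_le_two_mul_sum (M : ℕ) (s : ℕ → ℝ) :
    (∑ m ∈ Finset.range M, s m) ^ 2 ≤ 2 * ∑ m ∈ Finset.range M, ((m : ℝ) + 1) ^ 2 * s m ^ 2 := by
  have h1 : ∑ m ∈ Finset.range M, (((m : ℝ) + 1)⁻¹) ^ 2 ≤ 2 := by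
    have : ∀ M : ℕ, ∑ m ∈ Finset.range (M + 1), (((m : ℝ) + 1)⁻¹) ^ 2 ≤ 2 - ((M : ℝ) + 1)⁻¹ := by
      intro M
      induction M with
      | zero => norm_num
      | succ M ih =>
        rw [Finset.sum_range_succ]
        push_cast
        have h : (((M : ℝ) + 1 + 1)⁻¹) ^ 2 ≤ ((M : ℝ) + 1)⁻¹ - ((M : ℝ) + 1 + 1)⁻¹ := by
          rw [inv_sub_inv (by positivity) (by positivity), inv_pow, ← one_div]
          rw [div_le_div_iff₀ (by positivity) (by positivity)]
          nlinarith
        linarith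
    refine (Finset.sum_le_sum_of_subset_of_nonneg (Finset.range_subset_range.2 (Nat.le_succ M))
      fun _ _ _ => sq_nonneg _).trans ((this M).trans ?_)
    have : (0 : ℝ) ≤ ((M : ℝ) + 1)⁻¹ := by positivity
    linarith
  have h2 := Finset.sum_mul_sq_le_sq_mul_sq (Finset.range M) (fun m => ((m : ℝ) + 1)⁻¹)
    (fun m => ((m : ℝ) + 1) * s m)
  have e : ∀ m : ℕ, ((m : ℝ) + 1)⁻¹ * (((m : ℝ) + 1) * s m) = s m := fun m => by
    rw [inv_mul_cancel_left₀ (by positivity)]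
  simp only [e, mul_pow] at h2
  refine h2.trans ?_
  gcongr

end RademacherMenshov

/-! ### Pointwise maximal bound and convergence through rank blocks -/

section Blocks

/-- The finite block of indices of a given rank, for a rank function growing logarithmically. -/
def rankBlock (r : ℕ+ → ℕ) (m : ℕ) : Finset ℕ+ :=
  (Finset.Icc 1 ((2 : ℕ+) ^ (m + 1))).filter fun k => r k = m

theorem mem_rankBlock {r : ℕ+ → ℕ} (hr : ∀ k : ℕ+, (k : ℕ) < 2 ^ (r k + 1)) {m : ℕ} {k : ℕ+} :
    k ∈ rankBlock r m ↔ r k = m := by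
  rw [rankBlock, Finset.mem_filter, Finset.mem_Icc]
  refine ⟨fun h => h.2, fun h => ⟨⟨one_le, ?_⟩, h⟩⟩
  subst h
  rw [← PNat.coe_le_coe, PNat.pow_coe]
  exact (hr k).le

/-- The indices of rank `m` in a dyadic interval of length `2 ^ l`. -/
def dyadicBlock (r : ℕ+ → ℕ) (m l i : ℕ) : Finset ℕ+ :=
  (rankBlock r m).filter fun k => (k : ℕ) / 2 ^ l = i

/-- The square function of the block sums. -/
noncomputable def blockSquare (r : ℕ+ → ℕ) (N : Finset ℕ+ → ℝ≥0∞) (m : ℕ) : ℝ≥0∞ :=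
  ((m : ℝ≥0∞) + 1) ^ 2 * N (rankBlock r m)

/-- The square function of the dyadic sums inside a block. -/
noncomputable def dyadicSquare (r : ℕ+ → ℕ) (N : Finset ℕ+ → ℝ≥0∞) (m : ℕ) : ℝ≥0∞ :=
  ((m : ℝ≥0∞) + 2) * ∑ l ∈ Finset.range (m + 2), ∑ i ∈ Finset.range (2 ^ (m + 1)),
    N (dyadicBlock r m l i)

/-- The quadratic functional controlling the maximal function and the convergence of a series. -/
noncomputable def maximalSquare (r : ℕ+ → ℕ) (N : Finset ℕ+ → ℝ≥0∞) : ℝ≥0∞ :=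
  ∑' m, (4 * blockSquare r N m + 2 * dyadicSquare r N m)

variable {r : ℕ+ → ℕ} {x : ℕ+ → ℂ}

/-- Monotonicity of the rank makes the blocks consecutive, so only the last one is cut. -/
theorem sum_Icc_eq_sum_rankBlock (hr : ∀ k : ℕ+, (k : ℕ) < 2 ^ (r k + 1)) (hmono : Monotone r)
    (n : ℕ+) :
    ∑ k ∈ Finset.Icc 1 n, x k = ∑ m ∈ Finset.range (r n), ∑ k ∈ rankBlock r m, x k
      + ∑ k ∈ (rankBlock r (r n)).filter fun k : ℕ+ => (k : ℕ) < (n : ℕ) + 1, x k := by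
  rw [← Finset.sum_fiberwise_of_maps_to (s := Finset.Icc 1 n) (t := Finset.range (r n + 1)) (g := r)
    fun k hk => Finset.mem_range.2 (Nat.lt_succ_of_le (hmono (Finset.mem_Icc.1 hk).2)),
    Finset.sum_range_succ]
  congr 1
  · refine Finset.sum_congr rfl fun m hm => Finset.sum_congr ?_ fun _ _ => rfl
    ext k
    rw [Finset.mem_filter, mem_rankBlock hr, Finset.mem_Icc]
    refine ⟨fun h => h.2, fun h => ⟨⟨one_le, ?_⟩, h⟩⟩
    by_contra hlt
    have := hmono (not_le.1 hlt).le
    have := Finset.mem_range.1 hm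
    omega
  · refine Finset.sum_congr ?_ fun _ _ => rfl
    ext k
    rw [Finset.mem_filter, Finset.mem_filter, mem_rankBlock hr, Finset.mem_Icc, Nat.lt_succ_iff,
      PNat.coe_le_coe]
    simp [and_comm]

theorem enorm_sum_rankBlock_filter_sq_le (hr : ∀ k : ℕ+, (k : ℕ) < 2 ^ (r k + 1)) (m n : ℕ) :
    ‖∑ k ∈ (rankBlock r m).filter fun k : ℕ+ => (k : ℕ) < n, x k‖ₑ ^ 2
      ≤ dyadicSquare r (fun J => ‖∑ k ∈ J, x k‖ₑ ^ 2) m := by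
  have h := enorm_sum_filter_lt_sq_le (rankBlock r m) (fun k : ℕ+ => (k : ℕ)) x n (m + 1)
    fun k hk => by
      have := hr k
      rwa [(mem_rankBlock hr).1 hk] at this
  refine h.trans (le_of_eq ?_)
  simp only [dyadicSquare, dyadicBlock]
  push_cast
  ring

theorem enorm_sum_rankBlocks_sq_le (M : ℕ) :
    (∑ m ∈ Finset.range M, ‖∑ k ∈ rankBlock r m, x k‖ₑ) ^ 2
      ≤ 2 * ∑' m, blockSquare r (fun J => ‖∑ k ∈ J, x k‖ₑ ^ 2) m := by
  have h : (∑ m ∈ Finset.range M, ‖∑ k ∈ rankBlock r m, x k‖₊) ^ 2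
      ≤ 2 * ∑ m ∈ Finset.range M, ((m : ℝ≥0) + 1) ^ 2 * ‖∑ k ∈ rankBlock r m, x k‖₊ ^ 2 := by
    rw [← NNReal.coe_le_coe]
    push_cast
    exact sq_sum_le_two_mul_sum M _
  calc (∑ m ∈ Finset.range M, ‖∑ k ∈ rankBlock r m, x k‖ₑ) ^ 2
      ≤ 2 * ∑ m ∈ Finset.range M, blockSquare r (fun J => ‖∑ k ∈ J, x k‖ₑ ^ 2) m := by
        simp only [enorm_eq_nnnorm, blockSquare]
        exact_mod_cast h
    _ ≤ _ := by
        gcongr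
        exact ENNReal.sum_le_tsum _

theorem enorm_sum_Icc_sq_le_maximalSquare (hr : ∀ k : ℕ+, (k : ℕ) < 2 ^ (r k + 1)) (hmono : Monotone r)
    (n : ℕ+) :
    ‖∑ k ∈ Finset.Icc 1 n, x k‖ₑ ^ 2 ≤ maximalSquare r fun J => ‖∑ k ∈ J, x k‖ₑ ^ 2 := by
  rw [sum_Icc_eq_sum_rankBlock hr hmono, maximalSquare, ENNReal.tsum_add, ENNReal.tsum_mul_left,
    ENNReal.tsum_mul_left]
  refine (enorm_add_sq_le _ _).trans (add_le_add ?_ ?_)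
  · have h1 : ‖∑ m ∈ Finset.range (r n), ∑ k ∈ rankBlock r m, x k‖ₑ ^ 2
        ≤ (∑ m ∈ Finset.range (r n), ‖∑ k ∈ rankBlock r m, x k‖ₑ) ^ 2 := by
      gcongr
      exact enorm_sum_le _ _
    calc _ ≤ 2 * (2 * ∑' m, blockSquare r (fun J => ‖∑ k ∈ J, x k‖ₑ ^ 2) m) :=
          mul_le_mul_right (h1.trans (enorm_sum_rankBlocks_sq_le _)) 2
      _ = _ := by rw [← mul_assoc]; norm_num
  · exact mul_le_mul_right ((enorm_sum_rankBlock_filter_sq_le hr _ _).trans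
      (ENNReal.le_tsum (r n))) 2

theorem exists_tendsto_of_maximalSquare_ne_top (hr : ∀ k : ℕ+, (k : ℕ) < 2 ^ (r k + 1))
    (hmono : Monotone r) (hx : maximalSquare r (fun J => ‖∑ k ∈ J, x k‖ₑ ^ 2) ≠ ∞) :
    ∃ L, Tendsto (fun n : ℕ+ => ∑ k ∈ Finset.Icc 1 n, x k) atTop (𝓝 L) := by
  rw [maximalSquare, ENNReal.tsum_add, ENNReal.tsum_mul_left, ENNReal.tsum_mul_left,
    ENNReal.add_ne_top] at hx
  have hblock : ∑' m, blockSquare r (fun J => ‖∑ k ∈ J, x k‖ₑ ^ 2) m ≠ ∞ := fun h => by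
    simp [h] at hx
  have hdyadic : ∑' m, dyadicSquare r (fun J => ‖∑ k ∈ J, x k‖ₑ ^ 2) m ≠ ∞ := fun h => by
    simp [h] at hx
  have hrank : Tendsto r atTop atTop := by
    refine tendsto_atTop_atTop_of_monotone hmono fun b => ⟨(2 : ℕ+) ^ (b + 1), ?_⟩
    have := hr ((2 : ℕ+) ^ (b + 1))
    rw [PNat.pow_coe] at this
    have := (Nat.pow_lt_pow_iff_right (a := 2) (by norm_num)).1 this
    omega
  have hsummable : Summable fun m => ∑ k ∈ rankBlock r m, x k := by
    refine Summable.of_norm ?_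
    set S := (2 * ∑' m, blockSquare r (fun J => ‖∑ k ∈ J, x k‖ₑ ^ 2) m) with hS
    have hSt : S ≠ ∞ := ENNReal.mul_ne_top (by norm_num) hblock
    refine summable_of_sum_range_le (c := Real.sqrt S.toReal) (fun _ => norm_nonneg _) fun M => ?_
    refine Real.le_sqrt_of_sq_le ?_
    have h := ENNReal.toReal_mono hSt (enorm_sum_rankBlocks_sq_le (r := r) (x := x) M)
    rw [ENNReal.toReal_pow, ENNReal.toReal_sum fun _ _ => enorm_ne_top] at h
    simpa only [toReal_enorm] using h
  have hrem : Tendsto (fun n : ℕ+ => ∑ k ∈ (rankBlock r (r n)).filter fun k : ℕ+ => (k : ℕ) < (n : ℕ) + 1, x k)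
      atTop (𝓝 0) := by
    -- The incomplete block is bounded by a term of a convergent series whose index tends to
    -- infinity.
    have h0 := (ENNReal.tendsto_atTop_zero_of_tsum_ne_top hdyadic).comp hrank
    have h1 : Tendsto (fun n : ℕ+ =>
        ‖∑ k ∈ (rankBlock r (r n)).filter fun k : ℕ+ => (k : ℕ) < (n : ℕ) + 1, x k‖ₑ ^ 2) atTop (𝓝 0) :=
      tendsto_of_tendsto_of_tendsto_of_le_of_le tendsto_const_nhds h0 (fun _ => zero_le)
        fun n => enorm_sum_rankBlock_filter_sq_le hr _ _
    have h2 := (ENNReal.tendsto_toReal ENNReal.zero_ne_top).comp h1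
    simp only [Function.comp_def, ENNReal.toReal_pow, toReal_enorm, ENNReal.toReal_zero] at h2
    have h3 := h2.sqrt
    simp only [Real.sqrt_sq (norm_nonneg _), Real.sqrt_zero] at h3
    exact tendsto_zero_iff_norm_tendsto_zero.2 h3
  refine ⟨∑' m, ∑ k ∈ rankBlock r m, x k, ?_⟩
  have := (hsummable.hasSum.tendsto_sum_nat.comp hrank).add hrem
  rw [add_zero] at this
  exact this.congr fun n => (sum_Icc_eq_sum_rankBlock hr hmono n).symm

end Blocks

/-! ### Linearity and size of the quadratic functional -/

section MaximalSquare

variable {r : ℕ+ → ℕ} {N N' : Finset ℕ+ → ℝ≥0∞}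

theorem maximalSquare_mono (hr : ∀ k : ℕ+, (k : ℕ) < 2 ^ (r k + 1))
    (h : ∀ J m, (∀ k ∈ J, r k = m) → N J ≤ N' J) : maximalSquare r N ≤ maximalSquare r N' := by
  refine ENNReal.tsum_le_tsum fun m => ?_
  simp only [blockSquare, dyadicSquare]
  gcongr with l _ i _
  · exact h _ m fun k hk => (mem_rankBlock hr).1 hk
  · exact h _ m fun k hk => (mem_rankBlock hr).1 (Finset.mem_filter.1 hk).1

theorem maximalSquare_mul_right (c : ℝ≥0∞) :
    maximalSquare r (fun J => N J * c) = maximalSquare r N * c := by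
  simp only [maximalSquare, blockSquare, dyadicSquare]
  rw [← ENNReal.tsum_mul_right]
  refine tsum_congr fun m => ?_
  simp only [← Finset.sum_mul]
  ring

theorem lintegral_maximalSquare {α : Type*} [MeasurableSpace α] {ν : Measure α}
    {N : Finset ℕ+ → α → ℝ≥0∞} (hN : ∀ J, AEMeasurable (N J) ν) :
    ∫⁻ y, maximalSquare r (fun J => N J y) ∂ν = maximalSquare r fun J => ∫⁻ y, N J y ∂ν := by
  have hs : ∀ (m l : ℕ), AEMeasurable
      (fun y => ∑ i ∈ Finset.range (2 ^ (m + 1)), N (dyadicBlock r m l i) y) ν := fun m l =>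
    Finset.aemeasurable_fun_sum _ fun i _ => hN _
  have hss : ∀ m, AEMeasurable (fun y => ∑ l ∈ Finset.range (m + 2),
      ∑ i ∈ Finset.range (2 ^ (m + 1)), N (dyadicBlock r m l i) y) ν := fun m =>
    Finset.aemeasurable_fun_sum _ fun l _ => hs m l
  have ht : ∀ m, AEMeasurable (fun y => 4 * blockSquare r (fun J => N J y) m
      + 2 * dyadicSquare r (fun J => N J y) m) ν := fun m =>
    (((hN _).const_mul _).const_mul _).add (((hss m).const_mul _).const_mul _)
  simp only [maximalSquare]
  rw [lintegral_tsum ht]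
  refine tsum_congr fun m => ?_
  simp only [blockSquare, dyadicSquare]
  rw [lintegral_add_left' (((hN _).const_mul _).const_mul _),
    lintegral_const_mul'' _ ((hN _).const_mul _), lintegral_const_mul'' _ (hN _),
    lintegral_const_mul'' _ ((hss m).const_mul _), lintegral_const_mul'' _ (hss m),
    lintegral_finsetSum' _ fun l _ => hs m l]
  simp only [lintegral_finsetSum' _ fun i _ => hN _]

theorem aemeasurable_maximalSquare {α : Type*} [MeasurableSpace α] {ν : Measure α}
    {N : Finset ℕ+ → α → ℝ≥0∞} (hN : ∀ J, AEMeasurable (N J) ν) :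
    AEMeasurable (fun y => maximalSquare r fun J => N J y) ν := by
  refine AEMeasurable.tsum fun m => ?_
  exact (((hN _).const_mul _).const_mul _).add
    (((Finset.aemeasurable_fun_sum _ fun l _ =>
      Finset.aemeasurable_fun_sum _ fun i _ => hN _).const_mul _).const_mul _)

/-- Each of the `m + 2` dyadic scales partitions block `m`, so an additive set function is counted
`m + 2` times; the prefactor `m + 2` makes this a square. -/
theorem maximalSquare_sum_le (hr : ∀ k : ℕ+, (k : ℕ) < 2 ^ (r k + 1)) (β : ℕ+ → ℝ≥0∞) :
    maximalSquare r (fun J => ∑ k ∈ J, β k) ≤ 6 * ∑' k, ((r k : ℝ≥0∞) + 2) ^ 2 * β k := by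
  have hm : ∀ m : ℕ, 4 * blockSquare r (fun J => ∑ k ∈ J, β k) m
      + 2 * dyadicSquare r (fun J => ∑ k ∈ J, β k) m
      ≤ 6 * ∑ k ∈ rankBlock r m, ((r k : ℝ≥0∞) + 2) ^ 2 * β k := by
    intro m
    have hd : ∀ l, ∑ i ∈ Finset.range (2 ^ (m + 1)), ∑ k ∈ dyadicBlock r m l i, β k
        = ∑ k ∈ rankBlock r m, β k := fun l => by
      refine Finset.sum_fiberwise_of_maps_to (fun k hk => Finset.mem_range.2 ?_) _
      have := hr k
      rw [(mem_rankBlock hr).1 hk] at this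
      exact (Nat.div_le_self _ _).trans_lt this
    have hs : ∑ k ∈ rankBlock r m, ((r k : ℝ≥0∞) + 2) ^ 2 * β k
        = ((m : ℝ≥0∞) + 2) ^ 2 * ∑ k ∈ rankBlock r m, β k := by
      rw [Finset.mul_sum]
      exact Finset.sum_congr rfl fun k hk => by rw [(mem_rankBlock hr).1 hk]
    simp only [blockSquare, dyadicSquare, hd, hs, Finset.sum_const, Finset.card_range,
      nsmul_eq_mul]
    push_cast
    calc 4 * (((m : ℝ≥0∞) + 1) ^ 2 * ∑ k ∈ rankBlock r m, β k)
          + 2 * (((m : ℝ≥0∞) + 2) * (((m : ℝ≥0∞) + 2) * ∑ k ∈ rankBlock r m, β k))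
        ≤ 4 * (((m : ℝ≥0∞) + 2) ^ 2 * ∑ k ∈ rankBlock r m, β k)
          + 2 * (((m : ℝ≥0∞) + 2) * (((m : ℝ≥0∞) + 2) * ∑ k ∈ rankBlock r m, β k)) := by
          gcongr
          norm_num
      _ = _ := by ring
  refine (ENNReal.tsum_le_tsum hm).trans ?_
  rw [ENNReal.tsum_mul_left]
  gcongr
  have e : ∀ m, ∑ k ∈ rankBlock r m, ((r k : ℝ≥0∞) + 2) ^ 2 * β k
      = ∑' k, if r k = m then ((r k : ℝ≥0∞) + 2) ^ 2 * β k else 0 := fun m => by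
    rw [tsum_eq_sum (s := rankBlock r m) fun k hk => if_neg fun h => hk ((mem_rankBlock hr).2 h)]
    exact Finset.sum_congr rfl fun k hk => (if_pos ((mem_rankBlock hr).1 hk)).symm
  simp only [e]
  rw [ENNReal.tsum_comm]
  exact ENNReal.tsum_le_tsum fun k => (tsum_ite_eq' (r k) _).le

end MaximalSquare

/-! ### Ranks adapted to the growth of the exponents -/

section Weights

variable (p q : ℕ+ → ℕ)

/-- The bound `n ∨ p_n^* ∨ q_n^*` for the exponents of the first `n` terms. -/
def degreeBound (n : ℕ+) : ℕ := max (n : ℕ) (max (runMax p n) (runMax q n))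

/-- An integer version of `log (n ∨ p_n^* ∨ q_n^*)`, truncated at `n`. -/
def logWeight (n : ℕ+) : ℕ := min (Nat.log 2 (degreeBound p q n) + 1) n

/-- The rank of an index: both the index and its weight vary by a factor at most `2` among indices
of the same rank. -/
def logRank (n : ℕ+) : ℕ := Nat.log 2 (n * logWeight p q n)

theorem runMax_mono (c : ℕ+ → ℕ) : Monotone (runMax c) := fun _ _ h =>
  Finset.sup_mono (Finset.Icc_subset_Icc_right h)

theorem le_runMax (c : ℕ+ → ℕ) {k n : ℕ+} (h : k ≤ n) : c k ≤ runMax c n :=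
  Finset.le_sup (f := c) (Finset.mem_Icc.2 ⟨one_le, h⟩)

theorem degreeBound_mono : Monotone (degreeBound p q) := fun _ _ h =>
  max_le_max ((PNat.coe_le_coe _ _).2 h) (max_le_max (runMax_mono p h) (runMax_mono q h))

theorem logWeight_mono : Monotone (logWeight p q) := fun _ _ h =>
  min_le_min (Nat.add_le_add_right (Nat.log_mono_right (degreeBound_mono p q h)) 1)
    ((PNat.coe_le_coe _ _).2 h)

theorem logWeight_pos (n : ℕ+) : 0 < logWeight p q n := lt_min (Nat.succ_pos _) n.pos

theorem logRank_mono : Monotone (logRank p q) := fun _ _ h =>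
  Nat.log_mono_right (Nat.mul_le_mul ((PNat.coe_le_coe _ _).2 h) (logWeight_mono p q h))

theorem lt_two_pow_logRank (n : ℕ+) : (n : ℕ) < 2 ^ (logRank p q n + 1) :=
  (Nat.le_mul_of_pos_right _ (logWeight_pos p q n)).trans_lt
    (Nat.lt_pow_succ_log_self one_lt_two _)

/-- Index times weight varies by less than a factor 2 within a rank, and the index only increases
from `k` to `n`. -/
theorem logWeight_le_two_mul {k n : ℕ+} (hkn : k ≤ n) (h : logRank p q k = logRank p q n) :
    logWeight p q n ≤ 2 * logWeight p q k := by
  have h1 : (n : ℕ) * logWeight p q n < 2 ^ (logRank p q n + 1) :=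
    Nat.lt_pow_succ_log_self one_lt_two _
  have h2 : 2 ^ (logRank p q k) ≤ (k : ℕ) * logWeight p q k :=
    Nat.pow_log_le_self 2 (Nat.mul_pos k.pos (logWeight_pos p q k)).ne'
  rw [h] at h2
  have h3 : (k : ℕ) * logWeight p q k ≤ n * logWeight p q k :=
    Nat.mul_le_mul_right _ ((PNat.coe_le_coe _ _).2 hkn)
  rw [pow_succ] at h1
  refine le_of_mul_le_mul_left (a := (n : ℕ)) ?_ n.pos
  nlinarith

theorem natLog_two_le_mul_log (a : ℕ) : (Nat.log 2 a : ℝ) ≤ 3 / 2 * Real.log a := by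
  have h1 : (Nat.log 2 a : ℝ) ≤ Real.logb 2 a := Real.natLog_le_logb a 2
  have h2 := Real.log_two_gt_d9
  have h3 : 0 ≤ Real.log a := Real.log_natCast_nonneg a
  refine h1.trans ?_
  rw [Real.logb, div_le_iff₀ (by linarith)]
  nlinarith

/-- The cap gives `n * logWeight p q n ≤ n ^ 2`, so the rank is at most `3 * log n`; `log 2 > 2 / 3`
absorbs the additive constants. -/
theorem rank_weight_le (n : ℕ+) (hn : 2 ≤ (n : ℕ)) :
    ((logRank p q n : ℝ) + 2) ^ 2 * logWeight p q n
      ≤ 108 * (Real.log ((degreeBound p q n : ℕ) : ℝ) * Real.log (n : ℝ) ^ 2) := by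
  have h2 := Real.log_two_gt_d9
  have hl : Real.log 2 ≤ Real.log (n : ℝ) := Real.log_le_log (by norm_num) (by exact_mod_cast hn)
  have hdeg : (n : ℕ) ≤ degreeBound p q n := le_max_left _ _
  have hld : Real.log 2 ≤ Real.log ((degreeBound p q n : ℕ) : ℝ) :=
    Real.log_le_log (by norm_num) (by exact_mod_cast hn.trans hdeg)
  have hw : (logWeight p q n : ℝ) ≤ 3 * Real.log ((degreeBound p q n : ℕ) : ℝ) := by
    have h1 : (logWeight p q n : ℝ) ≤ Nat.log 2 (degreeBound p q n) + 1 := by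
      exact_mod_cast min_le_left _ _
    have h3 := natLog_two_le_mul_log (degreeBound p q n)
    linarith
  have hr : (logRank p q n : ℝ) + 2 ≤ 6 * Real.log (n : ℝ) := by
    have h1 : logRank p q n ≤ Nat.log 2 ((n : ℕ) ^ 2) := by
      refine Nat.log_mono_right ?_
      rw [sq]
      exact Nat.mul_le_mul_left _ (min_le_right _ _)
    have h3 := natLog_two_le_mul_log ((n : ℕ) ^ 2)
    rw [Nat.cast_pow, Real.log_pow] at h3
    have h4 : (logRank p q n : ℝ) ≤ Nat.log 2 ((n : ℕ) ^ 2) := by exact_mod_cast h1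
    push_cast at h3
    linarith
  calc ((logRank p q n : ℝ) + 2) ^ 2 * logWeight p q n
      ≤ (6 * Real.log (n : ℝ)) ^ 2 * (3 * Real.log ((degreeBound p q n : ℕ) : ℝ)) := by
        gcongr
    _ = _ := by ring

theorem tsum_rank_weight_ne_top (b : ℕ+ → ℝ≥0∞) (hb : ∀ n, b n ≠ ∞)
    (hsum : Summable fun n : ℕ+ => (b n).toReal
        * Real.log ((degreeBound p q n : ℕ) : ℝ) * Real.log (n : ℝ) ^ 2) :
    ∑' n, ((logRank p q n : ℝ≥0∞) + 2) ^ 2 * (logWeight p q n * b n) ≠ ∞ := by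
  have hs : Summable fun n : ℕ+ =>
      ((logRank p q n : ℝ) + 2) ^ 2 * (logWeight p q n * (b n).toReal) := by
    have h1 := hsum.mul_left 108
    refine Summable.of_norm_bounded_eventually h1 ?_
    -- The term `n = 1` must be set aside, since `log 1 = 0`.
    filter_upwards [(Set.finite_singleton (1 : ℕ+)).compl_mem_cofinite] with n hn
    have hn2 : 2 ≤ (n : ℕ) := by
      have h0 : (n : ℕ) ≠ 1 := fun h => hn (PNat.eq h)
      have := n.pos
      omega
    rw [Real.norm_of_nonneg (by positivity)]
    have := mul_le_mul_of_nonneg_right (rank_weight_le p q n hn2) (b n).toReal_nonneg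
    linarith
  have e : ∀ n, ((logRank p q n : ℝ≥0∞) + 2) ^ 2 * (logWeight p q n * b n)
      = ENNReal.ofReal (((logRank p q n : ℝ) + 2) ^ 2 * (logWeight p q n * (b n).toReal)) := by
    intro n
    rw [ENNReal.ofReal_mul (by positivity), ENNReal.ofReal_mul (by positivity),
      ENNReal.ofReal_toReal (hb n), ENNReal.ofReal_natCast, ENNReal.ofReal_pow (by positivity),
      ENNReal.ofReal_add (by positivity) (by norm_num), ENNReal.ofReal_natCast,
      ENNReal.ofReal_ofNat]
  simp only [e]
  rw [← ENNReal.ofReal_tsum_of_nonneg (fun n => by positivity) hs]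
  exact ENNReal.ofReal_ne_top

end Weights

/-! ### Random constants independent of the contractions -/

section Control

variable {Ω : Type u} [MeasurableSpace Ω] {μ : Measure Ω} [IsProbabilityMeasure μ]

/-- A random weighted sum of powers of two commuting contractions is bounded, uniformly in the
contractions, by a random constant whose second moment is logarithmic in the exponents. -/
theorem exists_control {X : ℕ+ → Ω → ℂ} (hm : ∀ k, Measurable (X k))
    (hL2 : ∀ k, MemLp (X k) 2 μ) (h0 : ∀ k, ∫ ω, X k ω ∂μ = 0) (hX : iIndepFun X μ)
    (p q : ℕ+ → ℕ) (J : Finset ℕ+) :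
    ∃ Z : Ω → ℝ≥0∞, Measurable Z ∧
      (∀ m, (∀ k ∈ J, logRank p q k = m) →
        ∫⁻ ω, Z ω ∂μ ≤ 4352 * ∑ k ∈ J, logWeight p q k * ∫⁻ ω, ‖X k ω‖ₑ ^ 2 ∂μ) ∧
      ∀ ω (H : Type v) [NormedAddCommGroup H] [InnerProductSpace ℂ H] [CompleteSpace H]
        (T₁ T₂ : H →L[ℂ] H), ‖T₁‖ ≤ 1 → ‖T₂‖ ≤ 1 → Commute T₁ T₂ → ∀ h : H,
        ‖∑ k ∈ J, X k ω • (T₁ ^ p k) ((T₂ ^ q k) h)‖ₑ ^ 2 ≤ Z ω * ‖h‖ₑ ^ 2 := by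
  rcases J.eq_empty_or_nonempty with rfl | hJ
  · exact ⟨fun _ => 0, measurable_const, by simp, by simp⟩
  set n := J.max' hJ with hn
  have hle : ∀ k ∈ J, k ≤ n := fun k hk => J.le_max' k hk
  have hnJ : n ∈ J := J.max'_mem hJ
  set D := degreeBound p q n with hD
  have hDpos : 0 < D := n.pos.trans_le (le_max_left _ _)
  have : NeZero D := ⟨hDpos.ne'⟩
  have hp : ∀ k ∈ J, p k ≤ D := fun k hk =>
    (le_runMax p (hle k hk)).trans ((le_max_left _ _).trans (le_max_right _ _))
  have hq : ∀ k ∈ J, q k ≤ D := fun k hk =>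
    (le_runMax q (hle k hk)).trans ((le_max_right _ _).trans (le_max_right _ _))
  let ζ := AddChar (ZMod (2 * D) × ZMod (2 * D)) ℂ
  let w : ℕ+ → ζ → ℂ := fun k χ => χ ((p k : ZMod (2 * D)), (q k : ZMod (2 * D)))
  have hw : ∀ k χ, ‖w k χ‖ ≤ 1 := fun k χ => (AddChar.norm_apply χ _).le
  have hmeas : Measurable fun ω => ‖∑ k ∈ J, X k ω • w k‖ₑ ^ 2 :=
    (Finset.measurable_fun_sum _ fun k _ => (hm k).smul_const (w k)).enorm.pow_const 2
  refine ⟨fun ω => 4 * ‖∑ k ∈ J, X k ω • w k‖ₑ ^ 2, hmeas.const_mul 4, fun m hJm => ?_, ?_⟩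
  · have hweight : ∫⁻ ω, ‖∑ k ∈ J, X k ω • w k‖ₑ ^ 2 ∂μ
        ≤ 544 * logWeight p q n * ∑ k ∈ J, ∫⁻ ω, ‖X k ω‖ₑ ^ 2 ∂μ := by
      -- The two sides of the cap: the type 2 bound with `(2D)²` characters, or Cauchy–Schwarz with
      -- at most `n` terms.
      rcases le_total (Nat.log 2 D + 1) (n : ℕ) with h | h
      · have e : logWeight p q n = Nat.log 2 D + 1 := min_eq_left h
        refine (lintegral_enorm_sum_smul_sq_le hm hL2 h0 hX w hw J).trans ?_
        gcongr
        rw [e, show (544 : ℝ≥0∞) * ((Nat.log 2 D + 1 : ℕ) : ℝ≥0∞)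
          = ENNReal.ofReal (544 * ((Nat.log 2 D + 1 : ℕ) : ℝ)) by
            rw [ENNReal.ofReal_mul (by norm_num), ENNReal.ofReal_natCast, ENNReal.ofReal_ofNat]]
        refine ENNReal.ofReal_le_ofReal ?_
        have hc : Fintype.card ζ = (2 * D) * (2 * D) := by
          rw [AddChar.card_eq, Fintype.card_prod, ZMod.card]
        rw [hc]
        have hlt : D ≤ 2 ^ (Nat.log 2 D + 1) := (Nat.lt_pow_succ_log_self one_lt_two D).le
        set l := Nat.log 2 D + 1 with hl
        have hl1 : (1 : ℝ) ≤ l := by rw [hl]; push_cast; linarith [(Nat.cast_nonneg (Nat.log 2 D) : (0 : ℝ) ≤ _)]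
        have hbound : (2 : ℝ) * ((2 * D * (2 * D) : ℕ) : ℝ) ≤ 2 ^ (2 * l + 3) := by
          have : 2 * (2 * D * (2 * D)) ≤ 2 ^ (2 * l + 3) := by
            calc 2 * (2 * D * (2 * D)) = 8 * (D * D) := by ring
              _ ≤ 8 * (2 ^ l * 2 ^ l) := by gcongr
              _ = 2 ^ (2 * l + 3) := by rw [pow_add, two_mul, pow_add]; ring
          exact_mod_cast this
        have hlog := Real.log_le_log (by positivity) hbound
        rw [Real.log_pow] at hlog
        push_cast at hlog ⊢
        have h2 := Real.log_two_lt_d9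
        nlinarith
      · have e : logWeight p q n = n := min_eq_right h
        refine (lintegral_enorm_sum_smul_sq_le_card hm w hw J).trans ?_
        gcongr
        have hcard : J.card ≤ n := by
          have : J ⊆ Finset.Icc 1 n := fun k hk => Finset.mem_Icc.2 ⟨one_le, hle k hk⟩
          simpa using Finset.card_le_card this
        rw [e]
        calc (J.card : ℝ≥0∞) ≤ (n : ℕ) := by exact_mod_cast hcard
          _ ≤ 544 * ((n : ℕ) : ℝ≥0∞) := le_mul_of_one_le_left zero_le (by norm_num)
    rw [lintegral_const_mul _ hmeas]
    calc 4 * ∫⁻ ω, ‖∑ k ∈ J, X k ω • w k‖ₑ ^ 2 ∂μ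
        ≤ 4 * (544 * logWeight p q n * ∑ k ∈ J, ∫⁻ ω, ‖X k ω‖ₑ ^ 2 ∂μ) := by gcongr
      _ = 2176 * ∑ k ∈ J, logWeight p q n * ∫⁻ ω, ‖X k ω‖ₑ ^ 2 ∂μ := by
          rw [← Finset.mul_sum, ← mul_assoc, ← mul_assoc, ← mul_assoc]
          norm_num
      _ ≤ 2176 * ∑ k ∈ J, (2 * logWeight p q k) * ∫⁻ ω, ‖X k ω‖ₑ ^ 2 ∂μ := by
          gcongr with k hk
          exact_mod_cast logWeight_le_two_mul p q (hle k hk) ((hJm k hk).trans (hJm n hnJ).symm)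
      _ = _ := by
          simp only [mul_assoc]
          rw [← Finset.mul_sum, ← mul_assoc]
          norm_num
  · intro ω H _ _ _ T₁ T₂ h₁ h₂ hT h
    have hC : ∀ χ : AddChar (ZMod (2 * D) × ZMod (2 * D)) ℂ,
        ‖∑ k ∈ J, X k ω * χ ((p k : ZMod (2 * D)), (q k : ZMod (2 * D)))‖
          ≤ ‖∑ k ∈ J, X k ω • w k‖₊ := fun χ => by
      refine le_trans (le_of_eq ?_) (norm_le_pi_norm (∑ k ∈ J, X k ω • w k) χ)
      simp [w]
    have := enorm_sum_smul_pow_pow_le T₁ T₂ h₁ h₂ hT J (fun k => X k ω) p q D hp hq hC h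
    calc _ ≤ (2 * (‖∑ k ∈ J, X k ω • w k‖₊ : ℝ≥0∞) * ‖h‖ₑ) ^ 2 := by gcongr
      _ = _ := by
        rw [mul_pow, mul_pow, ← enorm_eq_nnnorm]
        norm_num

end Control

/-! ### Transfer to `L₂(Y, π)` and conclusion -/

section Main

theorem lintegral_enorm_sum_mul_coeFn_sq {Y : Type v} [MeasurableSpace Y] {π : Measure Y}
    (J : Finset ℕ+) (a : ℕ+ → ℂ) (g : ℕ+ → Lp ℂ 2 π) :
    ∫⁻ y, ‖∑ k ∈ J, a k * g k y‖ₑ ^ 2 ∂π = ‖∑ k ∈ J, a k • g k‖ₑ ^ 2 := by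
  have hae : (fun y => ∑ k ∈ J, a k * g k y) =ᵐ[π] (∑ k ∈ J, a k • g k : Lp ℂ 2 π) := by
    have h1 : ∀ᵐ y ∂π, ∀ k ∈ J, (a k • g k : Lp ℂ 2 π) y = a k * g k y := by
      rw [Filter.eventually_all_finset]
      exact fun k _ => Lp.coeFn_smul (a k) (g k)
    have h2 := Lp.coeFn_finsetSum J fun k => a k • g k
    filter_upwards [h1, h2] with y hy1 hy2
    rw [hy2, Finset.sum_apply]
    exact Finset.sum_congr rfl fun k hk => (hy1 k hk).symm
  have h3 := eLpNorm_nnreal_pow_eq_lintegral (f := fun y => ∑ k ∈ J, a k * g k y) (μ := π)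
    (p := 2) two_ne_zero
  rw [Lp.enorm_def, ← eLpNorm_congr_ae hae]
  simpa using h3.symm

/-- The maximal inequality and the almost everywhere convergence follow from a bound for the sums
over all finite sets of indices. -/
theorem convergence_and_maximal_of_bound {Y : Type v} [MeasurableSpace Y] {π : Measure Y}
    {r : ℕ+ → ℕ} (hr : ∀ k : ℕ+, (k : ℕ) < 2 ^ (r k + 1)) (hmono : Monotone r)
    (a : ℕ+ → ℂ) (g : ℕ+ → Lp ℂ 2 π) (Z : Finset ℕ+ → ℝ≥0∞) (c : ℝ≥0∞) (hc : c ≠ ∞)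
    (hZ : maximalSquare r Z ≠ ∞) (hg : ∀ J, ‖∑ k ∈ J, a k • g k‖ₑ ^ 2 ≤ Z J * c ^ 2) :
    (∀ᵐ y ∂π, ∃ L, Tendsto (fun n : ℕ+ => ∑ k ∈ Finset.Icc 1 n, a k * g k y) atTop (𝓝 L)) ∧
      eLpNorm (fun y => ⨆ n : ℕ+, ‖∑ k ∈ Finset.Icc 1 n, a k * g k y‖ₑ) 2 π
        ≤ (NNReal.sqrt (maximalSquare r Z).toNNReal : ℝ≥0∞) * c := by
  have hmeas : ∀ J : Finset ℕ+, AEMeasurable (fun y => ‖∑ k ∈ J, a k * g k y‖ₑ ^ 2) π := fun J =>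
    (Finset.aemeasurable_fun_sum _ fun k _ =>
      (Lp.aestronglyMeasurable (g k)).aemeasurable.const_mul (a k)).enorm.pow_const 2
  have hint : ∫⁻ y, maximalSquare r (fun J => ‖∑ k ∈ J, a k * g k y‖ₑ ^ 2) ∂π
      ≤ maximalSquare r Z * c ^ 2 := by
    rw [lintegral_maximalSquare hmeas, ← maximalSquare_mul_right]
    refine maximalSquare_mono hr fun J m _ => ?_
    rw [lintegral_enorm_sum_mul_coeFn_sq]
    exact hg J
  have hfin : ∫⁻ y, maximalSquare r (fun J => ‖∑ k ∈ J, a k * g k y‖ₑ ^ 2) ∂π ≠ ∞ :=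
    (hint.trans_lt (ENNReal.mul_lt_top hZ.lt_top (ENNReal.pow_lt_top hc.lt_top))).ne
  refine ⟨?_, ?_⟩
  · filter_upwards [ae_lt_top' (aemeasurable_maximalSquare hmeas) hfin] with y hy
    exact exists_tendsto_of_maximalSquare_ne_top hr hmono hy.ne
  · have hsq : eLpNorm (fun y => ⨆ n : ℕ+, ‖∑ k ∈ Finset.Icc 1 n, a k * g k y‖ₑ) 2 π ^ 2
        ≤ ((NNReal.sqrt (maximalSquare r Z).toNNReal : ℝ≥0∞) * c) ^ 2 := by
      have h3 := eLpNorm_nnreal_pow_eq_lintegral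
        (f := fun y => ⨆ n : ℕ+, ‖∑ k ∈ Finset.Icc 1 n, a k * g k y‖ₑ) (μ := π)
        (p := 2) two_ne_zero
      have h4 : eLpNorm (fun y => ⨆ n : ℕ+, ‖∑ k ∈ Finset.Icc 1 n, a k * g k y‖ₑ) 2 π ^ 2
          = ∫⁻ y, (⨆ n : ℕ+, ‖∑ k ∈ Finset.Icc 1 n, a k * g k y‖ₑ) ^ 2 ∂π := by
        simpa using h3
      have h5 : (NNReal.sqrt (maximalSquare r Z).toNNReal : ℝ≥0∞) ^ 2 = maximalSquare r Z := by
        rw [← ENNReal.coe_pow, NNReal.sq_sqrt, ENNReal.coe_toNNReal hZ]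
      rw [h4, mul_pow, h5]
      refine (lintegral_mono fun y => ?_).trans hint
      have h6 : (⨆ n : ℕ+, ‖∑ k ∈ Finset.Icc 1 n, a k * g k y‖ₑ)
          ≤ (maximalSquare r fun J => ‖∑ k ∈ J, a k * g k y‖ₑ ^ 2) ^ (2⁻¹ : ℝ) := by
        refine iSup_le fun n => ?_
        rw [ENNReal.le_rpow_inv_iff (by norm_num)]
        exact_mod_cast enorm_sum_Icc_sq_le_maximalSquare (x := fun k => a k * g k y) hr hmono n
      rw [ENNReal.le_rpow_inv_iff (by norm_num)] at h6
      exact_mod_cast h6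
    exact (ENNReal.pow_right_strictMono two_ne_zero).le_iff_le.1 hsq

end Main

theorem theorem5p2 {Ω : Type u} [MeasurableSpace Ω] (μ : Measure Ω) [IsProbabilityMeasure μ]
    (X : ℕ+ → Ω → ℂ) (hL2 : ∀ n, MemLp (X n) 2 μ) (hcentered : ∀ n, ∫ ω, X n ω ∂μ = 0)
    (hindep : iIndepFun X μ) (p q : ℕ+ → ℕ)
    (hsum : Summable fun n : ℕ+ =>
      (eLpNorm (X n) 2 μ).toReal ^ 2
        * Real.log ((max (n : ℕ) (max (runMax p n) (runMax q n)) : ℕ) : ℝ)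
        * Real.log (n : ℝ) ^ 2) :
    ∀ᵐ ω ∂μ, ∃ K : ℝ≥0,
      ∀ (Y : Type v) [MeasurableSpace Y] (π : Measure Y) [IsProbabilityMeasure π]
        (T₁ T₂ : Lp ℂ 2 π →L[ℂ] Lp ℂ 2 π), ‖T₁‖ ≤ 1 → ‖T₂‖ ≤ 1 → Commute T₁ T₂ →
        ∀ f : Lp ℂ 2 π,
          (∀ᵐ y ∂π, ∃ L : ℂ,
            Tendsto (fun n => weightedPartialSum (fun k => X k ω) p q T₁ T₂ f n y)
              atTop (𝓝 L)) ∧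
          eLpNorm (fun y => ⨆ n : ℕ+,
              ‖weightedPartialSum (fun k => X k ω) p q T₁ T₂ f n y‖ₑ) 2 π
            ≤ (K : ℝ≥0∞) * eLpNorm f 2 π := by
  let X' : ℕ+ → Ω → ℂ := fun k => (hL2 k).aestronglyMeasurable.mk (X k)
  have hXX' : ∀ k, X k =ᵐ[μ] X' k := fun k => (hL2 k).aestronglyMeasurable.ae_eq_mk
  have hm : ∀ k, Measurable (X' k) := fun k =>
    (hL2 k).aestronglyMeasurable.stronglyMeasurable_mk.measurable
  have hL2' : ∀ k, MemLp (X' k) 2 μ := fun k => (memLp_congr_ae (hXX' k)).1 (hL2 k)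
  have h0' : ∀ k, ∫ ω, X' k ω ∂μ = 0 := fun k =>
    (integral_congr_ae (hXX' k)).symm.trans (hcentered k)
  have hind' : iIndepFun X' μ := hindep.congr hXX'
  have hr := lt_two_pow_logRank p q
  have hmono := logRank_mono p q
  choose Z hZm hZint hZ using exists_control.{u, v} hm hL2' h0' hind' p q
  have hb : ∀ k, ∫⁻ ω, ‖X' k ω‖ₑ ^ 2 ∂μ = eLpNorm (X k) 2 μ ^ 2 := fun k => by
    rw [eLpNorm_congr_ae (hXX' k)]
    have := eLpNorm_nnreal_pow_eq_lintegral (f := X' k) (μ := μ) (p := 2) two_ne_zero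
    simpa using this.symm
  have hQ : ∫⁻ ω, maximalSquare (logRank p q) (fun J => Z J ω) ∂μ ≠ ∞ := by
    have hfin := tsum_rank_weight_ne_top p q (fun k => eLpNorm (X k) 2 μ ^ 2)
      (fun k => ENNReal.pow_ne_top (hL2 k).eLpNorm_ne_top) (by
        simp only [ENNReal.toReal_pow]
        exact hsum)
    rw [lintegral_maximalSquare fun J => (hZm J).aemeasurable]
    refine ne_top_of_le_ne_top ?_ ((maximalSquare_mono hr
      (N' := fun J => (∑ k ∈ J, logWeight p q k * eLpNorm (X k) 2 μ ^ 2) * 4352)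
      fun J m hJ => ?_).trans ((maximalSquare_mul_right _).trans_le
        (mul_le_mul_left (maximalSquare_sum_le hr _) _)))
    · exact ENNReal.mul_ne_top (ENNReal.mul_ne_top (by norm_num) hfin) (by norm_num)
    · rw [mul_comm]
      simpa only [hb] using hZint J m hJ
  -- The exceptional set is fixed here, before any `Y`, operators or `f` are introduced.
  filter_upwards [ae_lt_top' (aemeasurable_maximalSquare fun J => (hZm J).aemeasurable) hQ,
    ae_all_iff.2 hXX'] with ω hω hXω
  refine ⟨NNReal.sqrt (maximalSquare (logRank p q) fun J => Z J ω).toNNReal, ?_⟩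
  intro Y _ π _ T₁ T₂ h₁ h₂ hT f
  refine convergence_and_maximal_of_bound hr hmono (fun k => X k ω)
    (fun k => (T₁ ^ p k) ((T₂ ^ q k) f)) (fun J => Z J ω) (eLpNorm f 2 π)
    (Lp.eLpNorm_ne_top f) hω.ne fun J => ?_
  have := hZ J ω (Lp ℂ 2 π) T₁ T₂ h₁ h₂ hT f
  rw [Lp.enorm_def] at this
  simpa only [hXω, Lp.enorm_def] using this
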